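/- Let $N\ge 1$ and $m\ge 0$ be integers. An $N$-periodic difference operator is a finite sum $L=\sum_k b^k\mathcal T^k$, $k\in\mathbb Z$, where the $b^k$ are $N$-periodic real sequences and $(\mathcal T f)_n=f_{n+1}$; operators are multiplied by the rule $\mathcal T b=(\mathcal T b)\mathcal T$. Let $L_+$, $L_0$, $L_-$ be the parts of $L$ of positive, zero and negative degree in $\mathcal T$, let $\mathrm{Tr}(L)=b^0$, let $\sum_n$ be the sum over one period, $\langle V,W\rangle=\sum_n\mathrm{Tr}(VW)_n$, $r(L)=\tfrac12(L_+-L_-)$ and $r^+(L)=L_++\tfrac12L_0$. Let $DO(N,m)$ be the space of operators $D=\sum_{i=0}^m a^i\mathcal T^i$. For a smooth function $\mathcal F$ on $DO(N,m)$ put $\delta_D\mathcal F=\sum_{i=0}^m\mathcal T^{-i}\delta_{a^i}\mathcal F$, where $(\delta_{a^i}\mathcal F)_n=\partial\mathcal F/\partial a^i_n$, so that $d\mathcal F_D(X)=\langle\delta_D\mathcal F,X\rangle$. The quadratic lattice $W_m$ bracket is $$\{\mathcal F,\mathcal G\}_1(D)=\sum_n\mathrm{Tr}\big((r(D\,\delta_D\mathcal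 F)D-D\,r(\delta_D\mathcal F\,D))\,\delta_D\mathcal G\big).$$ For $\lambda\neq0$ let $\phi_\lambda\big(\sum_{i=0}^m a^i\mathcal T^i\big)=\lambda^{-1}a^0+\sum_{i=1}^m a^i\mathcal T^i$, and let $$\{\mathcal F,\mathcal G\}^{(\lambda)}(D)=\{\mathcal F\circ\phi_\lambda,\mathcal G\circ\phi_\lambda\}_1(\phi_\lambda^{-1}(D))$$ be the push-forward of $\{\,,\}_1$ by $\phi_\lambda$. With $V=\delta_D\mathcal F$ and $W=\delta_D\mathcal G$, let $$\{\mathcal F,\mathcal G\}_2(D)=\sum_n\mathrm{Tr}\big(r^+(D_+V_-)D_0W_--r^+(V_-D_+)W_-D_0\big).$$ **Theorem.** 1. For every $\lambda\ne0$, $\{\,,\}^{(\lambda)}$ is a Poisson bracket on $C^\infty(DO(N,m))$. 2. There is a bracket $\{\,,\}^{(0)}$ such that $\{\,,\}^{(\lambda)}=\{\,,\}^{(0)}+\lambda\{\,,\}_2$ for all $\lambda\neq0$, and such that every combination $s\{\,,\}^{(0)}+t\{\,,\}_2$ with $s,t\in\mathbb R$ is a Poisson bracket. In particular $\{\,,\}^{(\lambda)}$,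 extended to $\lambda=0$ in this way, is a Poisson bracket for every $\lambda\in\mathbb R$ and is linear (of degree at most one) in $\lambda$: it is a Poisson pencil, and its $\lambda$-coefficient is $\{\,,\}_2$. 3. Let $m\ge1$. For all smooth $\mathcal F,\mathcal G$ and all $D\in DO(N,m)$ with $D_0=(-1)^{m-1}$, $$\{\mathcal F,\mathcal G\}_2(D)=(-1)^{m-1}\sum_n\mathrm{Tr}\big([D_+,V_-]_+W\big).$$ 4. Let $m\ge1$ and $\gcd(N,m)=1$, and let $S$ be the space of operators $D=(-1)^{m-1}+\sum_{i=1}^{m-1}a^i\mathcal T^i-\mathcal T^m$, with coordinates $(a^1,\dots,a^{m-1})$. By a gauge-invariant extension of a smooth function $f$ on $S$ we mean a function $\mathcal F$ on $DO(N,m)$ that extends $f$, is smooth at the points of $S$, and is invariant under $L\mapsto a^{-1}b^{-1}Lb$ for all positive $N$-periodic sequences $a$ and all positive sequences $b$ that are quasi-periodic ($b_{n+N}=q\,b_n$ for a constant $q$). Every smooth function on $S$ has a gauge-invariant extension. There is a Poisson bracket $\{\,,\}_2^{S}$ on $C^\infty(S)$ (the $SL(m)$ reduction of $\{\,,\}_2$)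 such that for all smooth $f,g$ on $S$, all gauge-invariant extensions $\mathcal F,\mathcal G$ of them, and all $D\in S$, $$\{f,g\}_2^{S}(D)=\{\mathcal F,\mathcal G\}_2(D)=(-1)^{m-1}\sum_n\mathrm{Tr}\big([D_+,V_-]_+W\big),\qquad V=\delta_D\mathcal F,\ W=\delta_D\mathcal G.$$ This bracket is linear: the bracket of two linear functions of $(a^1,\dots,a^{m-1})$ is a polynomial of degree at most one in these coordinates. -/

import Mathlib

open scoped ContDiff

noncomputable section

namespace DiffOp

/-! ### Periodic sequences and difference operators -/

/-- `N`-periodic real sequences `ℤ → ℝ`, viewed as functions on `ℤ / N`. -/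
abbrev Seq (N : ℕ) := ZMod N → ℝ

/-- The powers of the left shift `(𝒯 f)(n) = f (n + 1)` act on periodic sequences by ring
automorphisms: `(𝒯 ^ k f)(n) = f (n + k)`. The integer `k` is written multiplicatively. -/
instance shiftAction (N : ℕ) : MulSemiringAction (Multiplicative ℤ) (Seq N) where
  smul k f := fun n => f (n + ((Multiplicative.toAdd k : ℤ) : ZMod N))
  one_smul f := by
    funext n
    change f (n + (((0 : ℤ)) : ZMod N)) = f n
    simp
  mul_smul k l f := by
    funext n
    change f (n + (((Multiplicative.toAdd k + Multiplicative.toAdd l : ℤ)) : ZMod N)) =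
      f (n + ((Multiplicative.toAdd k : ℤ) : ZMod N) + ((Multiplicative.toAdd l : ℤ) : ZMod N))
    congr 1
    push_cast
    ring
  smul_zero _ := rfl
  smul_add _ _ _ := rfl
  smul_one _ := rfl
  smul_mul _ _ _ := rfl

/-- The associative ring of `N`-periodic operators `∑ b^k 𝒯^k` (finite sums over `k ∈ ℤ`), with
the multiplication determined by `𝒯 b = (𝒯 b) 𝒯`. It contains every operator that enters the
brackets below. -/
abbrev Op (N : ℕ) := SkewMonoidAlgebra (Seq N) (Multiplicative ℤ)

/-- The operator `𝒯^k`. -/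
def shift (N : ℕ) (k : ℤ) : Op N := SkewMonoidAlgebra.single (Multiplicative.ofAdd k) 1

/-- The order zero operator "multiplication by `b`". -/
def mulOp {N : ℕ} (b : Seq N) : Op N := SkewMonoidAlgebra.single 1 b

/-- `L_+`: the terms of `L` of strictly positive degree in `𝒯`. -/
def pos {N : ℕ} (L : Op N) : Op N :=
  ⟨L.coeff.filter (fun k => 0 < Multiplicative.toAdd k)⟩

/-- `L_-`: the terms of `L` of strictly negative degree in `𝒯`. -/
def neg {N : ℕ} (L : Op N) : Op N :=
  ⟨L.coeff.filter (fun k => Multiplicative.toAdd k < 0)⟩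

/-- `L_0`: the term of `L` of degree zero in `𝒯`. -/
def zer {N : ℕ} (L : Op N) : Op N := mulOp (L.coeff 1)

/-- `∑_n Tr(L)(n)`, the sum over one period of the coefficient of `𝒯^0`. -/
def sumTr {N : ℕ} [NeZero N] (L : Op N) : ℝ := ∑ n : ZMod N, L.coeff 1 n

/-- The inner product `⟨V, W⟩ = ∑_n Tr(V W)(n)`. -/
def pairing {N : ℕ} [NeZero N] (V W : Op N) : ℝ := sumTr (V * W)

/-- `r(L) = (L_+ - L_-) / 2`. -/
def rMat {N : ℕ} (L : Op N) : Op N := (1 / 2 : ℝ) • (pos L - neg L)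

/-- `r^+(L) = L_+ + L_0 / 2`. -/
def rPlus {N : ℕ} (L : Op N) : Op N := pos L + (1 / 2 : ℝ) • zer L

/-! ### Upper-triangular operators of order `m`, and variational derivatives -/

/-- The space `DO(N, m)` of operators `∑_{i=0}^m a^i 𝒯^i`, given by the coefficients `a^i`. -/
abbrev DO (N m : ℕ) := Fin (m + 1) → Seq N

/-- The operator `∑_{i=0}^m a^i 𝒯^i`. -/
def toOp {N m : ℕ} (a : DO N m) : Op N := ∑ i : Fin (m + 1), mulOp (a i) * shift N (i : ℕ)

/-- The operator `∑_{i=0}^m 𝒯^{-i} v^i`; these represent the linear functionals on `DO(N, m)`. -/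
def dualOp {N m : ℕ} (v : DO N m) : Op N :=
  ∑ i : Fin (m + 1), shift N (-((i : ℕ) : ℤ)) * mulOp (v i)

lemma pairing_dualOp {N m : ℕ} [NeZero N] (v a : DO N m) :
    pairing (dualOp v) (toOp a) = ∑ i, ∑ n, v i n * a i n := by
  have key : ∀ i j : Fin (m + 1),
      (shift N (-((i : ℕ) : ℤ)) * mulOp (v i)) * (mulOp (a j) * shift N ((j : ℕ) : ℤ)) =
        SkewMonoidAlgebra.single (Multiplicative.ofAdd (-((i : ℕ) : ℤ) + ((j : ℕ) : ℤ)))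
          (Multiplicative.ofAdd (-((i : ℕ) : ℤ)) • (v i * a j)) := by
    intro i j
    simp only [shift, mulOp, SkewMonoidAlgebra.single_mul_single, mul_one, one_mul, smul_one,
      ofAdd_add, smul_mul']
  have tr : ∀ i j : Fin (m + 1),
      sumTr ((shift N (-((i : ℕ) : ℤ)) * mulOp (v i)) * (mulOp (a j) * shift N ((j : ℕ) : ℤ))) =
        if i = j then ∑ n, v i n * a i n else 0 := by
    intro i j
    rw [key, sumTr, SkewMonoidAlgebra.coeff_single]
    by_cases h : i = j
    · subst h
      simp only [neg_add_cancel, ofAdd_zero, Finsupp.single_eq_same, if_true]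
      exact Fintype.sum_equiv (Equiv.addRight (((-((i : ℕ) : ℤ) : ℤ)) : ZMod N)) _ _
        (fun n => rfl)
    · have hne : Multiplicative.ofAdd (-((i : ℕ) : ℤ) + ((j : ℕ) : ℤ)) ≠ 1 := by
        intro h1
        have h2 : -((i : ℕ) : ℤ) + ((j : ℕ) : ℤ) = 0 := h1
        exact h (Fin.ext (by omega))
      rw [Finsupp.single_apply, if_neg hne, if_neg h]
      simp
  have hadd : ∀ (s : Finset (Fin (m + 1))) (f : Fin (m + 1) → Op N),
      sumTr (∑ i ∈ s, f i) = ∑ i ∈ s, sumTr (f i) := by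
    intro s f
    induction s using Finset.cons_induction with
    | empty => simp [sumTr]
    | cons i s hi ih =>
      rw [Finset.sum_cons, Finset.sum_cons, ← ih]
      simp [sumTr, Finset.sum_add_distrib]
  simp only [pairing, dualOp, toOp, Finset.sum_mul, Finset.mul_sum, hadd, tr]
  simp

/-- The variational derivative `δ_D F = ∑_{i=0}^m 𝒯^{-i} δ_{a^i} F`, where
`(δ_{a^i} F)(n) = ∂F / ∂a^i_n`. -/
def grad {N m : ℕ} [NeZero N] (F : DO N m → ℝ) (D : DO N m) : Op N :=
  dualOp fun i n => fderiv ℝ F D (Pi.single i (Pi.single n 1))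

/-- The defining property of the variational derivative. -/
lemma pairing_grad {N m : ℕ} [NeZero N] (F : DO N m → ℝ) (D X : DO N m) :
    pairing (grad F D) (toOp X) = fderiv ℝ F D X := by
  have hX : X = ∑ i, ∑ n, X i n • (Pi.single i (Pi.single n 1) : DO N m) := by
    funext i n
    simp only [Finset.sum_apply, Pi.smul_apply, smul_eq_mul, Pi.single_apply]
    rw [Finset.sum_eq_single i, Finset.sum_eq_single n] <;> simp +contextual [Ne.symm, eq_comm]
  conv_rhs => rw [hX]
  rw [grad, pairing_dualOp]
  simp only [map_sum, map_smul, smul_eq_mul]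
  exact Finset.sum_congr rfl fun i _ => Finset.sum_congr rfl fun n _ => mul_comm _ _

/-- It determines `δ_D F` among the operators `∑ 𝒯^{-i} v^i`. -/
lemma eq_of_pairing_eq {N m : ℕ} [NeZero N] (v w : DO N m)
    (h : ∀ X : DO N m, pairing (dualOp v) (toOp X) = pairing (dualOp w) (toOp X)) : v = w := by
  funext i n
  have := h (Pi.single i (Pi.single n 1))
  simpa [pairing_dualOp, Pi.single_apply, ite_apply, Finset.sum_ite_eq] using this

/-! ### Brackets -/

/-- `B` is a Poisson bracket on `C^∞(E)`: it preserves smoothness, is bilinear and skew-symmetric,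
and satisfies the Leibniz rule and the Jacobi identity. -/
structure IsPoissonBracket {E : Type*} [NormedAddCommGroup E] [NormedSpace ℝ E]
    (B : (E → ℝ) → (E → ℝ) → E → ℝ) : Prop where
  smooth : ∀ F G : E → ℝ, ContDiff ℝ ∞ F → ContDiff ℝ ∞ G → ContDiff ℝ ∞ (B F G)
  add_left : ∀ F G H : E → ℝ, ContDiff ℝ ∞ F → ContDiff ℝ ∞ G → ContDiff ℝ ∞ H →
    B (F + G) H = B F H + B G H
  smul_left : ∀ (c : ℝ) (F G : E → ℝ), ContDiff ℝ ∞ F → ContDiff ℝ ∞ G →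
    B (c • F) G = c • B F G
  skew : ∀ F G : E → ℝ, ContDiff ℝ ∞ F → ContDiff ℝ ∞ G → B F G = -B G F
  leibniz : ∀ F G H : E → ℝ, ContDiff ℝ ∞ F → ContDiff ℝ ∞ G → ContDiff ℝ ∞ H →
    B (F * G) H = F * B G H + G * B F H
  jacobi : ∀ F G H : E → ℝ, ContDiff ℝ ∞ F → ContDiff ℝ ∞ G → ContDiff ℝ ∞ H →
    B F (B G H) + B G (B H F) + B H (B F G) = 0

/-- The quadratic expression `∑ Tr((r(D V) D - D r(V D)) W)`. -/
def quadTensor {N : ℕ} [NeZero N] (D V W : Op N) : ℝ :=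
  pairing (rMat (D * V) * D - D * rMat (V * D)) W

/-- The quadratic bracket
`{F, G}₁(D) = ∑ Tr((r(D δ_D F) D - D r(δ_D F D)) δ_D G)`. -/
def bracket1 {N m : ℕ} [NeZero N] (F G : DO N m → ℝ) (D : DO N m) : ℝ :=
  quadTensor (toOp D) (grad F D) (grad G D)

/-- `φ_λ (∑_{i ≥ 0} a^i 𝒯^i) = λ⁻¹ a^0 + ∑_{i ≥ 1} a^i 𝒯^i`, a bijection of `DO(N, m)` for
every `λ ≠ 0`. -/
def phi (N m : ℕ) (l : ℝˣ) : DO N m ≃ DO N m where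
  toFun a i := if i = 0 then ((l⁻¹ : ℝˣ) : ℝ) • a i else a i
  invFun a i := if i = 0 then (l : ℝ) • a i else a i
  left_inv a := by
    funext i
    by_cases h : i = 0 <;> simp [h, smul_smul]
  right_inv a := by
    funext i
    by_cases h : i = 0 <;> simp [h, smul_smul]

/-- The push-forward of the quadratic bracket by `φ_λ`, `λ ≠ 0`:
`{F, G}_λ(D) = {F ∘ φ_λ, G ∘ φ_λ}₁(φ_λ⁻¹ D)`. -/
def pencil {N m : ℕ} [NeZero N] (l : ℝˣ) (F G : DO N m → ℝ) (D : DO N m) : ℝ :=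
  bracket1 (F ∘ phi N m l) (G ∘ phi N m l) ((phi N m l).symm D)

/-- The expression `∑ Tr(r^+(D_+ V_-) D_0 W_- - r^+(V_- D_+) W_- D_0)`. -/
def companionTensor {N : ℕ} [NeZero N] (D V W : Op N) : ℝ :=
  sumTr (rPlus (pos D * neg V) * zer D * neg W - rPlus (neg V * pos D) * neg W * zer D)

/-- The companion bracket
`{F, G}₂(D) = ∑ Tr(r^+(D_+ V_-) D_0 W_- - r^+(V_- D_+) W_- D_0)`, `V = δ_D F`, `W = δ_D G`. -/
def bracket2 {N m : ℕ} [NeZero N] (F G : DO N m → ℝ) (D : DO N m) : ℝ :=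
  companionTensor (toOp D) (grad F D) (grad G D)

/-- The expression `(-1)^{m-1} ∑ Tr([D_+, V_-]_+ W)`. -/
def linearTensor {N : ℕ} [NeZero N] (m : ℕ) (D V W : Op N) : ℝ :=
  (-1) ^ (m - 1) * sumTr (pos (pos D * neg V - neg V * pos D) * W)

/-! ### The `SL(m)` reduction -/

/-- The gauge transformation `L ↦ a⁻¹ b⁻¹ L b`, where `s = a⁻¹` is an `N`-periodic sequence and `b`
is a quasi-periodic one (`b (n + N) = q b n`). The latter enters only through the `N`-periodic
sequence `p = (𝒯 b) / b`, which may be any nowhere vanishing one: the coefficient of `𝒯^k` is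
multiplied by `s (𝒯^k b) / b = s p (𝒯 p) ⋯ (𝒯^{k-1} p)`. -/
def gauge {N m : ℕ} (s p : Seq N) (L : DO N m) : DO N m := fun k =>
  s * L k * ∏ j ∈ Finset.range (k : ℕ), Multiplicative.ofAdd (j : ℤ) • p

/-- Invariance under the gauge transformations with positive `a` and `b`. -/
def IsGaugeInvariant {N m : ℕ} (F : DO N m → ℝ) : Prop :=
  ∀ s p : Seq N, (∀ n, 0 < s n) → (∀ n, 0 < p n) → ∀ L, F (gauge s p L) = F L

/-- The coordinates `(a^1, …, a^{m-1})` on the space of operators with `a^0 = (-1)^{m-1}` and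
`a^m = -1`; `a j` is the coefficient of `𝒯^{j+1}`. -/
abbrev Slice (N m : ℕ) := Fin (m - 1) → Seq N

/-- The operator `(-1)^{m-1} + ∑_{i=1}^{m-1} a^i 𝒯^i - 𝒯^m`. -/
def sliceOp {N m : ℕ} (a : Slice N m) : DO N m := fun i =>
  if h0 : (i : ℕ) = 0 then fun _ => (-1) ^ (m - 1)
  else if hm : (i : ℕ) = m then fun _ => -1
  else a ⟨(i : ℕ) - 1, by have := i.isLt; omega⟩

/-- `F` is a gauge-invariant extension, smooth at the operators `sliceOp a`, of the function `f`
on the reduced space. Reduced brackets of functions are brackets of such extensions, and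
`δ_D F` is then the reduced variational derivative of `f`. -/
structure IsInvariantExtension {N m : ℕ} [NeZero N] (f : Slice N m → ℝ) (F : DO N m → ℝ) :
    Prop where
  invariant : IsGaugeInvariant F
  smooth : ∀ a : Slice N m, ContDiffAt ℝ ∞ F (sliceOp a)
  extends_f : ∀ a : Slice N m, F (sliceOp a) = f a

end DiffOp

end

/-!
The quadratic bracket is the Sklyanin bracket of the ring of difference operators with the trace
`∑_n Tr` and the skew map `r = (P_+ - P_-) / 2`. The trace is cyclic (`sumTr_mul_comm`), and `r`
satisfies the modified Yang–Baxter equation; only the version paired with a third operator and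
symmetrized is needed, and this is checked on monomials, where it is an identity between signs of
three integers with sum zero (`sumTr_yangBaxter`). The Jacobi identity for linear functions
is then a matter of cyclicity (`sklyanin_jacobi`). It extends to all smooth functions because the
terms with second derivatives cancel (`isPoissonBracket_of_bivector`); here the Hamiltonian vector
fields have to be tangent to `DO(N, m)` (`hamOp_mem`). Push-forward by the linear maps `φ_λ`
preserves all this.

In the variables rescaled by `φ_λ`, write `D = D_+ + λ D_0` and `V = V_- + λ⁻¹ V_0`. Expanding the
quadratic tensor and cancelling by cyclicity, the term with `λ⁻¹` disappears and the one with `λ`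
is `⟨D_+, V_- D_0 W_- - W_- D_0 V_-⟩` (`quadTensor_scale`), which is also the tensor of the
companion bracket (`companionTensor_eq`). So the pencil is affine in `λ`. The Jacobiator of
`s B + t B'` for two Poisson brackets is `s t` times an expression that does not depend on `s` and
`t`; three members of the pencil therefore suffice to make all combinations
Poisson brackets (`IsPoissonBracket.combination`, `isPoissonBracket_combination`).

In the last form of the companion tensor neither the derivative with respect to `a^0` nor, for
reasons of degree, that with respect to `a^m` occurs. Hence `a^0` and `a^m` are Casimir functions,
and the companion bracket restricts to the slice: at its points it depends only on the restrictions
of the functions (`bracket2_congr`), whichever way they are extended. This gives the reduced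
bracket, its Jacobi identity, and its linearity. Coprimality of `N` and `m` is needed only for the
existence of gauge-invariant extensions. The gauge transformation from `L` to the slice amounts to
the equation `q + 𝒯 q + ⋯ + 𝒯^{m-1} q = c` for the logarithm `q` of `(𝒯 b) / b`, which has a unique
periodic solution (`windowSum_injective`); the extension is `f` of the resulting normal form where
`(-1)^{m-1} a^0 > 0` and `a^m < 0`, and zero elsewhere.
-/

noncomputable section

namespace DiffOp

/-! ### Trace and splitting of the ring of periodic operators -/

section Algebra

variable {N : ℕ}

instance shift_smulCommClass : SMulCommClass (Multiplicative ℤ) ℝ (Seq N) :=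
  ⟨fun _ _ _ => rfl⟩

lemma shiftAction_apply (k : Multiplicative ℤ) (f : Seq N) (n : ZMod N) :
    (k • f) n = f (n + ((Multiplicative.toAdd k : ℤ) : ZMod N)) := rfl

/-- `L ↦ L_+` as a linear map. -/
def posₗ : Op N →ₗ[ℝ] Op N where
  toFun := pos
  map_add' L M := by ext k; simp [pos, Finsupp.filter_add]
  map_smul' c L := by ext k; simp [pos, Finsupp.filter_smul]

/-- `L ↦ L_-` as a linear map. -/
def negₗ : Op N →ₗ[ℝ] Op N where
  toFun := neg
  map_add' L M := by ext k; simp [neg, Finsupp.filter_add]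
  map_smul' c L := by ext k; simp [neg, Finsupp.filter_smul]

/-- The classical `r`-matrix `r(L) = (L_+ - L_-) / 2` as a linear map. -/
def rMatₗ : Op N →ₗ[ℝ] Op N := (1 / 2 : ℝ) • (posₗ - negₗ)

lemma rMatₗ_apply (L : Op N) : rMatₗ L = rMat L := rfl

/-- `L ↦ ∑_n Tr(L)(n)` as a linear functional. -/
def sumTrₗ [NeZero N] : Op N →ₗ[ℝ] ℝ where
  toFun := sumTr
  map_add' L M := by simp [sumTr, Finset.sum_add_distrib]
  map_smul' c L := by simp [sumTr, Finset.mul_sum]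

lemma sumTrₗ_apply [NeZero N] (L : Op N) : sumTrₗ L = sumTr L := rfl

lemma coeff_pos (L : Op N) (k : Multiplicative ℤ) :
    (pos L).coeff k = if 0 < Multiplicative.toAdd k then L.coeff k else 0 := by
  simp [pos, Finsupp.filter_apply]

lemma coeff_neg_part (L : Op N) (k : Multiplicative ℤ) :
    (neg L).coeff k = if Multiplicative.toAdd k < 0 then L.coeff k else 0 := by
  simp [neg, Finsupp.filter_apply]

lemma coeff_zer (L : Op N) (k : Multiplicative ℤ) :
    (zer L).coeff k = if k = 1 then L.coeff k else 0 := by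
  classical
  rw [zer, mulOp, SkewMonoidAlgebra.coeff_single_apply]
  by_cases h : k = 1
  · simp [h]
  · rw [if_neg h, if_neg (Ne.symm h)]

lemma rMat_single (k : Multiplicative ℤ) (b : Seq N) :
    rMat (SkewMonoidAlgebra.single k b) =
      ((SignType.sign (Multiplicative.toAdd k) : ℝ) / 2) • SkewMonoidAlgebra.single k b := by
  classical
  ext l : 1
  rw [rMat, SkewMonoidAlgebra.coeff_smul, SkewMonoidAlgebra.coeff_smul,
    SkewMonoidAlgebra.coeff_sub, Finsupp.smul_apply, Finsupp.smul_apply, Finsupp.sub_apply,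
    coeff_pos, coeff_neg_part, SkewMonoidAlgebra.coeff_single_apply]
  by_cases h : k = l
  · subst h
    rcases lt_trichotomy (Multiplicative.toAdd k) 0 with h | h | h
    · simp [h, h.not_gt, neg_div]
    · simp [h]
    · simp [h, h.le]
  · simp [h]

lemma sumTr_single [NeZero N] (k : Multiplicative ℤ) (b : Seq N) :
    sumTr (SkewMonoidAlgebra.single k b) = if k = 1 then ∑ n, b n else 0 := by
  classical
  rw [sumTr, SkewMonoidAlgebra.coeff_single_apply]
  split_ifs <;> simp

lemma sum_smul_shift [NeZero N] (k : Multiplicative ℤ) (b : Seq N) :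
    ∑ n, (k • b) n = ∑ n, b n :=
  Fintype.sum_equiv (Equiv.addRight ((Multiplicative.toAdd k : ℤ) : ZMod N)) _ _ fun _ => rfl

/-- A linear identity on operators may be checked on the monomials `b 𝒯^k`. -/
lemma op_induction {p : Op N → Prop} (L : Op N)
    (single : ∀ k b, p (SkewMonoidAlgebra.single k b)) (add : ∀ L M, p L → p M → p (L + M)) :
    p L :=
  SkewMonoidAlgebra.induction_on L (by simpa using single 1 0) single (fun L M => add L M)

/-- The trace form is symmetric. -/
lemma sumTr_mul_comm [NeZero N] (L M : Op N) : sumTrₗ (L * M) = sumTrₗ (M * L) := by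
  induction L using op_induction with
  | add L L' h h' => simp [add_mul, mul_add, h, h']
  | single k b =>
    induction M using op_induction with
    | add M M' h h' => simp [add_mul, mul_add, h, h']
    | single l c =>
      simp only [sumTrₗ_apply, SkewMonoidAlgebra.single_mul_single, sumTr_single]
      by_cases h : k * l = 1
      · rw [if_pos h, if_pos (by rw [mul_comm, h]), ← sum_smul_shift l (b * k • c)]
        rw [smul_mul', smul_smul, mul_comm l k, h, one_smul, mul_comm]
      · rw [if_neg h, if_neg (by rwa [mul_comm])]

/-- `r` is skew-adjoint for the trace form. -/
lemma sumTr_rMat_mul [NeZero N] (L M : Op N) :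
    sumTrₗ (rMatₗ L * M) = -sumTrₗ (L * rMatₗ M) := by
  induction L using op_induction with
  | add L L' h h' => simp only [add_mul, map_add, h, h']; ring
  | single k b =>
    induction M using op_induction with
    | add M M' h h' => simp only [mul_add, map_add, h, h']; ring
    | single l c =>
      simp only [rMatₗ_apply, rMat_single, smul_mul_assoc, mul_smul_comm, map_smul, smul_eq_mul,
        SkewMonoidAlgebra.single_mul_single, sumTrₗ_apply, sumTr_single]
      by_cases h : k * l = 1
      · have : Multiplicative.toAdd l = -Multiplicative.toAdd k := by
          rw [eq_inv_of_mul_eq_one_right h]; rfl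
        rw [if_pos h, this, Left.sign_neg]
        push_cast
        ring
      · simp [h]

/-- The modified Yang–Baxter equation for `r`, paired with a third element and symmetrized. On
monomials of degrees `i + j + k = 0` it says that
`sign i * sign j + sign j * sign k + sign k * sign i = -1`, unless `i = j = k = 0`, where the
commutator vanishes. -/
lemma sumTr_yangBaxter [NeZero N] (L M K : Op N) :
    sumTrₗ ((rMatₗ L * rMatₗ M - rMatₗ M * rMatₗ L) * K) +
      sumTrₗ ((rMatₗ M * rMatₗ K - rMatₗ K * rMatₗ M) * L) +
      sumTrₗ ((rMatₗ K * rMatₗ L - rMatₗ L * rMatₗ K) * M) =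
    -(1 / 4) * sumTrₗ ((L * M - M * L) * K) := by
  induction L using op_induction with
  | add L L' h h' =>
    simp only [mul_add, add_mul, sub_mul, map_add, map_sub] at h h' ⊢
    linear_combination h + h'
  | single i a =>
  induction M using op_induction with
  | add M M' h h' =>
    simp only [mul_add, add_mul, sub_mul, map_add, map_sub] at h h' ⊢
    linear_combination h + h'
  | single j b =>
  induction K using op_induction with
  | add M M' h h' =>
    simp only [mul_add, add_mul, sub_mul, map_add, map_sub] at h h' ⊢
    linear_combination h + h'
  | single k c =>
  simp only [rMatₗ_apply, rMat_single, smul_mul_assoc, mul_smul_comm, sub_mul, map_sub, map_smul,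
    smul_eq_mul]
  set A : Op N := SkewMonoidAlgebra.single i a with hA
  set B : Op N := SkewMonoidAlgebra.single j b with hB
  set C : Op N := SkewMonoidAlgebra.single k c with hC
  have e1 : sumTrₗ (B * C * A) = sumTrₗ (A * B * C) := by
    rw [sumTr_mul_comm, mul_assoc]
  have e2 : sumTrₗ (C * A * B) = sumTrₗ (A * B * C) := by
    rw [mul_assoc, sumTr_mul_comm]
  have e3 : sumTrₗ (C * B * A) = sumTrₗ (B * A * C) := by
    rw [mul_assoc, sumTr_mul_comm]
  have e4 : sumTrₗ (A * C * B) = sumTrₗ (B * A * C) := by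
    rw [sumTr_mul_comm, mul_assoc]
  rw [e1, e2, e3, e4]
  by_cases h : i * j * k = 1
  · have hs : Multiplicative.toAdd i + Multiplicative.toAdd j + Multiplicative.toAdd k = 0 := h
    by_cases h0 : i = 1 ∧ j = 1
    · have : A * B = B * A := by
        rw [hA, hB, SkewMonoidAlgebra.single_mul_single, SkewMonoidAlgebra.single_mul_single,
          h0.1, h0.2, one_smul, one_smul, mul_comm a b]
      rw [this]; ring
    · have h0' : ¬ (Multiplicative.toAdd i = 0 ∧ Multiplicative.toAdd j = 0) := h0
      obtain hi | hi | hi := lt_trichotomy (Multiplicative.toAdd i) 0 <;>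
      obtain hj | hj | hj := lt_trichotomy (Multiplicative.toAdd j) 0 <;>
      obtain hk | hk | hk := lt_trichotomy (Multiplicative.toAdd k) 0 <;>
      first
      | omega
      | (simp only [sign_neg, sign_pos, hi, hj, hk, sign_zero, SignType.coe_neg, SignType.coe_one,
          SignType.coe_zero]
         ring)
  · have z1 : sumTrₗ (A * B * C) = 0 := by
      rw [sumTrₗ_apply, hA, hB, hC, SkewMonoidAlgebra.single_mul_single,
        SkewMonoidAlgebra.single_mul_single, sumTr_single, if_neg h]
    have z2 : sumTrₗ (B * A * C) = 0 := by
      rw [sumTrₗ_apply, hA, hB, hC, SkewMonoidAlgebra.single_mul_single,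
        SkewMonoidAlgebra.single_mul_single, sumTr_single, if_neg (by rwa [mul_comm j i])]
    rw [z1, z2]; ring

end Algebra

/-- The Jacobi identity of the Sklyanin bracket `τ ((r (D V) D - D r (V D)) W)` on an associative
algebra with trace `τ`, for linear functions `τ (V ·)`: here `x V` is the Hamiltonian vector field
of `τ (V ·)` at `D`, and `dP X V W` is the derivative at `D`, in the direction `X`, of the bracket of
`τ (V ·)` and `τ (W ·)`. -/
lemma sklyanin_jacobi {A : Type*} [Ring A] [Algebra ℝ A] (τ : A →ₗ[ℝ] ℝ) (r : A →ₗ[ℝ] A)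
    (comm : ∀ a b, τ (a * b) = τ (b * a)) (skew : ∀ a b, τ (r a * b) = -τ (a * r b))
    (yb : ∀ a b c, τ ((r a * r b - r b * r a) * c) + τ ((r b * r c - r c * r b) * a) +
      τ ((r c * r a - r a * r c) * b) = -(1 / 4) * τ ((a * b - b * a) * c))
    (D V₁ V₂ V₃ : A) (x : A → A) (hx : ∀ V, x V = r (D * V) * D - D * r (V * D))
    (dP : A → A → A → ℝ) (hdP : ∀ X V W, dP X V W =
      τ ((r (X * V) * D + r (D * V) * X - X * r (V * D) - D * r (V * X)) * W)) :
    dP (x V₁) V₂ V₃ + dP (x V₂) V₃ V₁ + dP (x V₃) V₁ V₂ = 0 := by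
  -- the direction `X` is isolated by skew-adjointness of `r` and cyclicity
  have step : ∀ X V W, dP X V W =
      τ (X * (W * r (D * V) - V * r (D * W) + r (W * D) * V - r (V * D) * W)) := by
    intro X V W
    have h1 := skew (X * V) (D * W)
    have h2 := comm (r (D * V)) (X * W)
    have h3 := skew (V * X) (W * D)
    have h4 := comm V (X * r (W * D))
    have h5 := comm (D * r (V * X)) W
    have h6 := comm (W * D) (r (V * X))
    have h7 := comm (r (D * V) * X) W
    have h8 := comm W (X * r (D * V))
    rw [hdP]
    simp only [mul_add, add_mul, sub_mul, mul_sub, map_add, map_sub, mul_assoc] at *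
    linarith
  have yA := yb (D * V₁) (D * V₂) (D * V₃)
  have yB := yb (V₁ * D) (V₂ * D) (V₃ * D)
  have c1 := comm D (V₁ * (D * (V₂ * (D * V₃))))
  have c2 := comm D (V₂ * (D * (V₁ * (D * V₃))))
  -- with `aᵢ = r (D Vᵢ)` and `bᵢ = r (Vᵢ D)`, the mixed words cancel in the cyclic sum
  have key : ∀ a₁ a₂ a₃ b₁ b₂ b₃ : A,
      τ ((a₁ * D - D * b₁) * (V₃ * a₂ - V₂ * a₃ + b₃ * V₂ - b₂ * V₃)) +
      τ ((a₂ * D - D * b₂) * (V₁ * a₃ - V₃ * a₁ + b₁ * V₃ - b₃ * V₁)) +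
      τ ((a₃ * D - D * b₃) * (V₂ * a₁ - V₁ * a₂ + b₂ * V₁ - b₁ * V₂)) =
      -(τ ((a₁ * a₂ - a₂ * a₁) * (D * V₃)) + τ ((a₂ * a₃ - a₃ * a₂) * (D * V₁)) +
        τ ((a₃ * a₁ - a₁ * a₃) * (D * V₂))) +
      (τ ((b₁ * b₂ - b₂ * b₁) * (V₃ * D)) + τ ((b₂ * b₃ - b₃ * b₂) * (V₁ * D)) +
        τ ((b₃ * b₁ - b₁ * b₃) * (V₂ * D))) := by
    intro a₁ a₂ a₃ b₁ b₂ b₃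
    -- words with two factors `a` and one `D V`, resp. two factors `b` and one `V D`
    have wa : ∀ a V a' : A, τ (a * (D * (V * a'))) = τ (a' * (a * (D * V))) := by
      intro a V a'
      rw [comm a']; simp only [mul_assoc]
    have wb : ∀ b b' V : A, τ (D * (b * (b' * V))) = τ (b * (b' * (V * D))) := by
      intro b b' V
      rw [comm]; simp only [mul_assoc]
    -- mixed words
    have wm : ∀ V a b : A, τ (V * (a * (D * b))) = τ (b * (V * (a * D))) := by
      intro V a b
      rw [comm b]; simp only [mul_assoc]
    simp only [mul_add, sub_mul, mul_sub, map_add, map_sub, mul_assoc, wa, wb]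
    linarith [wm V₂ a₁ b₃, wm V₃ a₁ b₂, wm V₃ a₂ b₁, wm V₁ a₂ b₃, wm V₁ a₃ b₂, wm V₂ a₃ b₁]
  simp only [step, hx]
  rw [key]
  simp only [sub_mul, mul_assoc, map_sub] at *
  linarith

/-! ### Poisson brackets on a vector space -/

section Poisson

variable {E : Type*} [NormedAddCommGroup E] [NormedSpace ℝ E]

lemma fderiv_hamiltonian {Λ : E → (E →L[ℝ] ℝ) →L[ℝ] E} {G H : E → ℝ} {x : E}
    (hΛ : DifferentiableAt ℝ Λ x) (hG : DifferentiableAt ℝ (fderiv ℝ G) x)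
    (hH : DifferentiableAt ℝ (fderiv ℝ H) x) (u : E) :
    fderiv ℝ (fun y => fderiv ℝ H y (Λ y (fderiv ℝ G y))) x u =
      fderiv ℝ (fderiv ℝ H) x u (Λ x (fderiv ℝ G x)) +
      fderiv ℝ H x (fderiv ℝ Λ x u (fderiv ℝ G x)) +
      fderiv ℝ H x (Λ x (fderiv ℝ (fderiv ℝ G) x u)) := by
  rw [fderiv_clm_apply hH (hΛ.clm_apply hG), fderiv_clm_apply hΛ hG]
  simp only [_root_.add_apply, ContinuousLinearMap.comp_apply,
    ContinuousLinearMap.flip_apply, map_add]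
  ring

/-- A smooth bivector field `Λ`, viewed as a map from covectors to vectors, defines a Poisson
bracket as soon as the Jacobi identity holds for linear functions: the terms with second
derivatives of the functions cancel because `Λ` is skew and second derivatives are symmetric. -/
lemma isPoissonBracket_of_bivector (Λ : E → (E →L[ℝ] ℝ) →L[ℝ] E) (hΛ : ContDiff ℝ ∞ Λ)
    (skew : ∀ (x : E) (α β : E →L[ℝ] ℝ), β (Λ x α) = -α (Λ x β))
    (jac : ∀ (x : E) (α β γ : E →L[ℝ] ℝ), γ (fderiv ℝ Λ x (Λ x α) β) +
      α (fderiv ℝ Λ x (Λ x β) γ) + β (fderiv ℝ Λ x (Λ x γ) α) = 0) :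
    IsPoissonBracket fun F G x => fderiv ℝ G x (Λ x (fderiv ℝ F x)) where
  smooth F G hF hG :=
    (hG.fderiv_right (m := ∞) (by simp)).clm_apply
      (hΛ.clm_apply (hF.fderiv_right (m := ∞) (by simp)))
  add_left F G H hF hG hH := by
    funext x
    simp only [Pi.add_apply]
    rw [fderiv_add (hF.differentiable (by simp) x) (hG.differentiable (by simp) x),
      map_add, map_add]
  smul_left c F G hF hG := by
    funext x
    simp only [Pi.smul_apply]
    rw [fderiv_const_smul (hF.differentiable (by simp) x), map_smul, map_smul]
  skew F G hF hG := by
    funext x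
    exact skew x _ _
  leibniz F G H hF hG hH := by
    funext x
    simp only [Pi.add_apply, Pi.mul_apply]
    rw [fderiv_mul (hF.differentiable (by simp) x) (hG.differentiable (by simp) x)]
    simp only [map_add, map_smul, smul_eq_mul]
  jacobi F G H hF hG hH := by
    funext x
    have dd : ∀ K : E → ℝ, ContDiff ℝ ∞ K → DifferentiableAt ℝ (fderiv ℝ K) x := fun K hK =>
      (hK.fderiv_right (m := ∞) (by simp)).differentiable (by simp) x
    have sym : ∀ K : E → ℝ, ContDiff ℝ ∞ K → ∀ u v,
        fderiv ℝ (fderiv ℝ K) x u v = fderiv ℝ (fderiv ℝ K) x v u := fun K hK =>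
      (hK.contDiffAt (x := x)).isSymmSndFDerivAt (by simpa using ENat.LEInfty.out)
    have hd := hΛ.differentiable (by simp) x
    simp only [Pi.add_apply, Pi.zero_apply, fderiv_hamiltonian hd, dd F hF, dd G hG, dd H hH]
    have h1 := skew x (fderiv ℝ (fderiv ℝ G) x (Λ x (fderiv ℝ F x))) (fderiv ℝ H x)
    have h2 := skew x (fderiv ℝ (fderiv ℝ H) x (Λ x (fderiv ℝ G x))) (fderiv ℝ F x)
    have h3 := skew x (fderiv ℝ (fderiv ℝ F) x (Λ x (fderiv ℝ H x))) (fderiv ℝ G x)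
    have s1 := sym F hF (Λ x (fderiv ℝ G x)) (Λ x (fderiv ℝ H x))
    have s2 := sym G hG (Λ x (fderiv ℝ H x)) (Λ x (fderiv ℝ F x))
    have s3 := sym H hH (Λ x (fderiv ℝ F x)) (Λ x (fderiv ℝ G x))
    have j := jac x (fderiv ℝ F x) (fderiv ℝ G x) (fderiv ℝ H x)
    linarith

lemma contDiff_and_fderiv_diagonal [FiniteDimensional ℝ E] {E' : Type*} [NormedAddCommGroup E']
    [NormedSpace ℝ E'] (b : E →ₗ[ℝ] E →ₗ[ℝ] E') :
    ContDiff ℝ ∞ (fun x => b x x) ∧ ∀ x u, fderiv ℝ (fun x => b x x) x u = b x u + b u x := by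
  have h : (fun x => b x x) = fun x => b.toContinuousBilinearMap x x := rfl
  rw [h]
  refine ⟨(ContinuousLinearMap.contDiff _).clm_apply contDiff_id, fun x u => ?_⟩
  rw [fderiv_clm_apply (by fun_prop) (by fun_prop)]
  simp

namespace IsPoissonBracket

variable {B B' : (E → ℝ) → (E → ℝ) → E → ℝ}

lemma add_right (hB : IsPoissonBracket B) {F G H : E → ℝ} (hF : ContDiff ℝ ∞ F)
    (hG : ContDiff ℝ ∞ G) (hH : ContDiff ℝ ∞ H) : B F (G + H) = B F G + B F H := by
  have hGH : ContDiff ℝ ∞ (G + H) := hG.add hH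
  rw [hB.skew _ _ hF hGH, hB.add_left _ _ _ hG hH hF, hB.skew F G hF hG,
    hB.skew F H hF hH, neg_add]

lemma smul_right (hB : IsPoissonBracket B) (c : ℝ) {F G : E → ℝ} (hF : ContDiff ℝ ∞ F)
    (hG : ContDiff ℝ ∞ G) : B F (c • G) = c • B F G := by
  have hc : ContDiff ℝ ∞ (c • G) := contDiff_const.smul hG
  rw [hB.skew _ _ hF hc, hB.smul_left _ _ _ hG hF, hB.skew F G hF hG,
    smul_neg]

/-- The Jacobi identity of `s B + t B'` for two Poisson brackets reduces to a condition on the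
pair that does not depend on `s` and `t`, with the factor `s t`. -/
lemma jacobiator_combination (hB : IsPoissonBracket B) (hB' : IsPoissonBracket B') (s t : ℝ)
    {F G H : E → ℝ} (hF : ContDiff ℝ ∞ F) (hG : ContDiff ℝ ∞ G) (hH : ContDiff ℝ ∞ H) :
    (s • B F (s • B G H + t • B' G H) + t • B' F (s • B G H + t • B' G H)) +
      (s • B G (s • B H F + t • B' H F) + t • B' G (s • B H F + t • B' H F)) +
      (s • B H (s • B F G + t • B' F G) + t • B' H (s • B F G + t • B' F G)) =
    (s * t) • ((B F (B' G H) + B G (B' H F) + B H (B' F G)) +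
      (B' F (B G H) + B' G (B H F) + B' H (B F G))) := by
  have ex : ∀ P : (E → ℝ) → (E → ℝ) → E → ℝ, IsPoissonBracket P → ∀ K L M : E → ℝ,
      ContDiff ℝ ∞ K → ContDiff ℝ ∞ L → ContDiff ℝ ∞ M →
      P K (s • B L M + t • B' L M) = s • P K (B L M) + t • P K (B' L M) := by
    intro P hP K L M hK hL hM
    have h1 := hB.smooth _ _ hL hM
    have h2 := hB'.smooth _ _ hL hM
    have h3 : ContDiff ℝ ∞ (s • B L M) := contDiff_const.smul h1
    have h4 : ContDiff ℝ ∞ (t • B' L M) := contDiff_const.smul h2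
    rw [hP.add_right hK h3 h4,
      hP.smul_right _ hK h1, hP.smul_right _ hK h2]
  rw [ex B hB F G H hF hG hH, ex B' hB' F G H hF hG hH, ex B hB G H F hG hH hF,
    ex B' hB' G H F hG hH hF, ex B hB H F G hH hF hG, ex B' hB' H F G hH hF hG]
  have j := hB.jacobi F G H hF hG hH
  have j' := hB'.jacobi F G H hF hG hH
  funext x
  have jx := congrFun j x
  have jx' := congrFun j' x
  simp only [Pi.add_apply, Pi.smul_apply, smul_eq_mul, Pi.zero_apply] at jx jx' ⊢
  linear_combination s ^ 2 * jx + t ^ 2 * jx'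

/-- If one combination of two Poisson brackets, with nonzero coefficients, is a Poisson bracket,
then the two brackets are compatible: all their combinations are Poisson brackets. -/
lemma combination (hB : IsPoissonBracket B) (hB' : IsPoissonBracket B') {s₀ t₀ : ℝ}
    (hs : s₀ ≠ 0) (ht : t₀ ≠ 0)
    (h₀ : IsPoissonBracket fun F G => s₀ • B F G + t₀ • B' F G) (s t : ℝ) :
    IsPoissonBracket fun F G => s • B F G + t • B' F G where
  smooth F G hF hG :=
    (contDiff_const.smul (hB.smooth F G hF hG)).add (contDiff_const.smul (hB'.smooth F G hF hG))
  add_left F G H hF hG hH := by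
    rw [hB.add_left F G H hF hG hH, hB'.add_left F G H hF hG hH]
    module
  smul_left c F G hF hG := by
    rw [hB.smul_left c F G hF hG, hB'.smul_left c F G hF hG]
    module
  skew F G hF hG := by
    rw [hB.skew F G hF hG, hB'.skew F G hF hG]
    module
  leibniz F G H hF hG hH := by
    rw [hB.leibniz F G H hF hG hH, hB'.leibniz F G H hF hG hH]
    funext x
    simp only [Pi.add_apply, Pi.smul_apply, Pi.mul_apply, smul_eq_mul]
    ring
  jacobi F G H hF hG hH := by
    have h := h₀.jacobi F G H hF hG hH
    rw [hB.jacobiator_combination hB' _ _ hF hG hH] at h ⊢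
    rw [(smul_eq_zero.mp h).resolve_left (mul_ne_zero hs ht), smul_zero]

/-- The push-forward of a Poisson bracket by a linear isomorphism. -/
lemma map (hB : IsPoissonBracket B) (e : E ≃L[ℝ] E) :
    IsPoissonBracket fun F G x => B (F ∘ e) (G ∘ e) (e.symm x) where
  smooth F G hF hG :=
    (hB.smooth _ _ (hF.comp e.contDiff) (hG.comp e.contDiff)).comp e.symm.contDiff
  add_left F G H hF hG hH := by
    funext x
    exact congrFun (hB.add_left _ _ _ (hF.comp e.contDiff) (hG.comp e.contDiff)
      (hH.comp e.contDiff)) _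
  smul_left c F G hF hG := by
    funext x
    exact congrFun (hB.smul_left c _ _ (hF.comp e.contDiff) (hG.comp e.contDiff)) _
  skew F G hF hG := by
    funext x
    exact congrFun (hB.skew _ _ (hF.comp e.contDiff) (hG.comp e.contDiff)) _
  leibniz F G H hF hG hH := by
    funext x
    have h := congrFun (hB.leibniz _ _ _ (hF.comp e.contDiff) (hG.comp e.contDiff)
      (hH.comp e.contDiff)) (e.symm x)
    simp only [Pi.add_apply, Pi.mul_apply, Function.comp_apply, e.apply_symm_apply] at h ⊢
    exact h
  jacobi F G H hF hG hH := by
    funext x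
    have h := congrFun (hB.jacobi _ _ _ (hF.comp e.contDiff) (hG.comp e.contDiff)
      (hH.comp e.contDiff)) (e.symm x)
    have c : ∀ K : E → ℝ, (fun x => K (e.symm x)) ∘ e = K := fun K => by
      funext y; simp
    simp only [Pi.add_apply, Pi.zero_apply, c] at h ⊢
    exact h

end IsPoissonBracket

end Poisson

/-! ### The quadratic bracket -/

section Quadratic

variable {N m : ℕ}

/-- `a ↦ ∑ a^i 𝒯^i` as a linear map. -/
def toOpₗ : DO N m →ₗ[ℝ] Op N where
  toFun := toOp
  map_add' a b := by
    simp [toOp, mulOp, SkewMonoidAlgebra.single_add, add_mul, Finset.sum_add_distrib]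
  map_smul' c a := by
    simp [toOp, mulOp, shift, SkewMonoidAlgebra.single_mul_single, SkewMonoidAlgebra.smul_single,
      Finset.smul_sum]

lemma toOpₗ_apply (a : DO N m) : toOpₗ a = toOp a := rfl

/-- `v ↦ ∑ 𝒯^{-i} v^i` as a linear map. -/
def dualOpₗ : DO N m →ₗ[ℝ] Op N where
  toFun := dualOp
  map_add' a b := by
    simp [dualOp, mulOp, SkewMonoidAlgebra.single_add, mul_add, Finset.sum_add_distrib]
  map_smul' c a := by
    simp [dualOp, mulOp, shift, SkewMonoidAlgebra.single_mul_single,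
      SkewMonoidAlgebra.smul_single, Finset.smul_sum, smul_comm]

/-- The operator `∑ 𝒯^{-i} v^i` that represents a linear functional on `DO(N, m)`. -/
def covOpₗ : (DO N m →L[ℝ] ℝ) →ₗ[ℝ] Op N :=
  dualOpₗ ∘ₗ
    { toFun := fun α i n => α (Pi.single i (Pi.single n 1))
      map_add' := fun _ _ => rfl
      map_smul' := fun _ _ => rfl }

lemma covOpₗ_fderiv [NeZero N] (F : DO N m → ℝ) (D : DO N m) :
    covOpₗ (fderiv ℝ F D) = grad F D := rfl

lemma sumTr_covOpₗ_mul [NeZero N] (α : DO N m →L[ℝ] ℝ) (X : DO N m) :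
    sumTrₗ (covOpₗ α * toOp X) = α X := by
  have h := pairing_grad (fun Y => α Y) X X
  have e : fderiv ℝ (fun Y => α Y) X = α := α.fderiv
  rw [← covOpₗ_fderiv, e] at h
  exact h

lemma coeff_finset_sum {ι : Type*} (s : Finset ι) (f : ι → Op N) (k : Multiplicative ℤ) :
    (∑ i ∈ s, f i).coeff k = ∑ i ∈ s, (f i).coeff k := by
  induction s using Finset.cons_induction with
  | empty => simp
  | cons i s hi ih => rw [Finset.sum_cons, Finset.sum_cons, ← ih]; simp

lemma coeff_toOp (a : DO N m) (k : Multiplicative ℤ) :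
    (toOp a).coeff k = ∑ i : Fin (m + 1), if Multiplicative.toAdd k = (i : ℤ) then a i else 0 := by
  classical
  rw [toOp, coeff_finset_sum]
  refine Finset.sum_congr rfl fun i _ => ?_
  rw [mulOp, shift, SkewMonoidAlgebra.single_mul_single, one_mul, one_smul, mul_one,
    SkewMonoidAlgebra.coeff_single_apply]
  exact if_congr ⟨fun h => by rw [← h]; rfl, fun h => by rw [← h]; rfl⟩ rfl rfl

/-- The coefficients of `𝒯^0, …, 𝒯^m` of an operator. -/
def coeffsₗ : Op N →ₗ[ℝ] DO N m where
  toFun L i := L.coeff (Multiplicative.ofAdd ((i : ℕ) : ℤ))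
  map_add' _ _ := by funext i; simp
  map_smul' _ _ := by funext i; simp

/-- Operators all of whose terms have degree in `S`. -/
def degIn (N : ℕ) (S : Set ℤ) : Submodule ℝ (Op N) where
  carrier := {L | ∀ k, Multiplicative.toAdd k ∉ S → L.coeff k = 0}
  add_mem' ha hb k hk := by simp [ha k hk, hb k hk]
  zero_mem' k _ := by simp
  smul_mem' c a ha k hk := by simp [ha k hk]

lemma mul_mem_degIn {S T U : Set ℤ} (h : ∀ s ∈ S, ∀ t ∈ T, s + t ∈ U) {L M : Op N}
    (hL : L ∈ degIn N S) (hM : M ∈ degIn N T) : L * M ∈ degIn N U := by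
  classical
  intro k hk
  rw [SkewMonoidAlgebra.coeff_mul]
  rw [SkewMonoidAlgebra.sum_def']
  refine Finset.sum_eq_zero fun i hi => ?_
  rw [SkewMonoidAlgebra.sum_def']
  refine Finset.sum_eq_zero fun j hj => ?_
  rw [SkewMonoidAlgebra.mem_support_iff] at hi hj
  refine if_neg fun hij => hk ?_
  rw [← hij]
  exact h _ (by_contra fun h' => hi (hL _ h')) _ (by_contra fun h' => hj (hM _ h'))

lemma sumTr_eq_zero_of_mem_degIn [NeZero N] {S : Set ℤ} (hS : (0 : ℤ) ∉ S) {L : Op N}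
    (hL : L ∈ degIn N S) : sumTrₗ L = 0 := by
  rw [sumTrₗ_apply, sumTr, hL 1 hS]
  simp

lemma pos_mem (L : Op N) : pos L ∈ degIn N (Set.Ioi 0) := fun k hk => by
  rw [coeff_pos, if_neg (show ¬0 < Multiplicative.toAdd k from hk)]

lemma neg_mem (L : Op N) : neg L ∈ degIn N (Set.Iio 0) := fun k hk => by
  rw [coeff_neg_part, if_neg (show ¬Multiplicative.toAdd k < 0 from hk)]

lemma zer_mem (L : Op N) : zer L ∈ degIn N {0} := fun k hk => by
  rw [coeff_zer, if_neg fun h => hk (by rw [h]; rfl)]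

lemma degIn_mono {S T : Set ℤ} (h : S ⊆ T) {L : Op N} (hL : L ∈ degIn N S) : L ∈ degIn N T :=
  fun k hk => hL k fun h' => hk (h h')

lemma toOp_mem (a : DO N m) : toOp a ∈ degIn N (Set.Icc 0 m) := fun k hk => by
  rw [coeff_toOp]
  refine Finset.sum_eq_zero fun i _ => if_neg fun h => hk ?_
  rw [h]
  exact ⟨by omega, by have := i.isLt; omega⟩

/-- An operator with terms of degree `0, …, m` only belongs to `DO(N, m)`. -/
lemma toOp_coeffsₗ {L : Op N} (hL : L ∈ degIn N (Set.Icc 0 m)) :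
    toOp (coeffsₗ L : DO N m) = L := by
  ext k : 1
  rw [coeff_toOp]
  by_cases h : Multiplicative.toAdd k ∈ Set.Icc (0 : ℤ) m
  · obtain ⟨j, hj⟩ := Int.eq_ofNat_of_zero_le h.1
    have h' := h.2
    rw [Finset.sum_eq_single (⟨j, by omega⟩ : Fin (m + 1))]
    · rw [if_pos hj]
      change L.coeff (Multiplicative.ofAdd (j : ℤ)) = L.coeff k
      rw [← hj]; rfl
    · intro i _ hi
      refine if_neg fun h => hi (Fin.ext ?_)
      change (i : ℕ) = j
      omega
    · simp
  · rw [hL k h]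
    refine Finset.sum_eq_zero fun i _ => if_neg fun h' => h ?_
    rw [h']
    exact ⟨by omega, by have := i.isLt; omega⟩

lemma pos_add_zer_add_neg (L : Op N) : pos L + zer L + neg L = L := by
  ext k : 1
  simp only [SkewMonoidAlgebra.coeff_add, Finsupp.add_apply, coeff_pos, coeff_neg_part, coeff_zer]
  have h1 : k = 1 ↔ Multiplicative.toAdd k = 0 := Iff.rfl
  simp only [h1]
  rcases lt_trichotomy (Multiplicative.toAdd k) 0 with h | h | h
  · simp [h, h.not_gt, h.ne]
  · simp [h]
  · simp [h, h.not_gt, h.ne']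

lemma half_smul_sub {M : Type*} [AddCommGroup M] [Module ℝ M] (p z n : M) :
    (1 / 2 : ℝ) • (p - n) = p + (1 / 2 : ℝ) • z - (1 / 2 : ℝ) • (p + z + n) ∧
      (1 / 2 : ℝ) • (p - n) = (1 / 2 : ℝ) • (p + z + n) - (n + (1 / 2 : ℝ) • z) :=
  ⟨by module, by module⟩

/-- The Hamiltonian vector field `r(D V) D - D r(V D)` of the functional `⟨V, ·⟩`. -/
def hamOp (D V : Op N) : Op N := rMat (D * V) * D - D * rMat (V * D)

/-- The Hamiltonian vector fields are tangent to `DO(N, m)`: `r` differs from a projection to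
nonnegative degrees, and from one to nonpositive degrees, by a multiple of the identity, which
does not contribute. -/
lemma hamOp_mem {D : Op N} (hD : D ∈ degIn N (Set.Icc 0 m)) (V : Op N) :
    hamOp D V ∈ degIn N (Set.Icc 0 m) := by
  have split : ∀ L : Op N, L = pos L + zer L + neg L := fun L => (pos_add_zer_add_neg L).symm
  have plus : ∀ L : Op N, rMat L = (pos L + (1 / 2 : ℝ) • zer L) - (1 / 2 : ℝ) • L := by
    intro L
    rw [show (1 / 2 : ℝ) • L = (1 / 2 : ℝ) • (pos L + zer L + neg L) by rw [← split], rMat]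
    exact (half_smul_sub _ _ _).1
  have minus : ∀ L : Op N, rMat L = (1 / 2 : ℝ) • L - (neg L + (1 / 2 : ℝ) • zer L) := by
    intro L
    rw [show (1 / 2 : ℝ) • L = (1 / 2 : ℝ) • (pos L + zer L + neg L) by rw [← split], rMat]
    exact (half_smul_sub _ _ _).2
  have hplus : ∀ L : Op N, pos L + (1 / 2 : ℝ) • zer L ∈ degIn N (Set.Ici 0) := fun L =>
    add_mem (degIn_mono Set.Ioi_subset_Ici_self (pos_mem L))
      (Submodule.smul_mem _ _ (degIn_mono (by simp) (zer_mem L)))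
  have hminus : ∀ L : Op N, neg L + (1 / 2 : ℝ) • zer L ∈ degIn N (Set.Iic 0) := fun L =>
    add_mem (degIn_mono Set.Iio_subset_Iic_self (neg_mem L))
      (Submodule.smul_mem _ _ (degIn_mono (by simp) (zer_mem L)))
  have h1 : hamOp D V = (pos (D * V) + (1 / 2 : ℝ) • zer (D * V)) * D -
      D * (pos (V * D) + (1 / 2 : ℝ) • zer (V * D)) := by
    rw [hamOp, plus, plus]
    simp only [sub_mul, mul_sub, smul_mul_assoc, mul_smul_comm, mul_assoc]
    abel
  have h2 : hamOp D V = D * (neg (V * D) + (1 / 2 : ℝ) • zer (V * D)) -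
      (neg (D * V) + (1 / 2 : ℝ) • zer (D * V)) * D := by
    rw [hamOp, minus, minus]
    simp only [sub_mul, mul_sub, smul_mul_assoc, mul_smul_comm, mul_assoc]
    abel
  have lo : hamOp D V ∈ degIn N (Set.Ici 0) := by
    have add : ∀ s ∈ Set.Ici (0 : ℤ), ∀ t ∈ Set.Ici (0 : ℤ), s + t ∈ Set.Ici (0 : ℤ) :=
      fun s hs t ht => add_nonneg (Set.mem_Ici.1 hs) (Set.mem_Ici.1 ht)
    have hD' := degIn_mono Set.Icc_subset_Ici_self hD
    rw [h1]
    exact sub_mem (mul_mem_degIn add (hplus _) hD') (mul_mem_degIn add hD' (hplus _))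
  have hi : hamOp D V ∈ degIn N (Set.Iic m) := by
    have hD' := degIn_mono Set.Icc_subset_Iic_self hD
    rw [h2]
    refine sub_mem (mul_mem_degIn ?_ hD' (hminus _)) (mul_mem_degIn ?_ (hminus _) hD') <;>
      intro s hs t ht <;> simp only [Set.mem_Iic] at * <;> omega
  intro k hk
  by_cases h : 0 ≤ Multiplicative.toAdd k
  · exact hi k fun h' => hk ⟨h, h'⟩
  · exact lo k h

/-- The polarized Hamiltonian vector field, bilinear in the two operators. -/
def hamBilin (V : Op N) : DO N m →ₗ[ℝ] DO N m →ₗ[ℝ] DO N m :=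
  LinearMap.mk₂ ℝ
    (fun D X => coeffsₗ (rMatₗ (toOpₗ X * V) * toOpₗ D - toOpₗ D * rMatₗ (V * toOpₗ X)))
    (fun D D' X => by simp only [map_add, mul_add, add_mul, map_sub]; abel)
    (fun c D X => by simp only [map_smul, mul_smul_comm, smul_mul_assoc, map_sub, smul_sub])
    (fun D X X' => by simp only [map_add, mul_add, add_mul, map_sub]; abel)
    (fun c D X => by simp only [map_smul, mul_smul_comm, smul_mul_assoc, map_sub, smul_sub])

variable [NeZero N]

/-- The bivector field of the quadratic bracket, mapping covectors to vectors. -/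
def hamMap (D : DO N m) : (DO N m →L[ℝ] ℝ) →L[ℝ] DO N m :=
  LinearMap.toContinuousLinearMap
    { toFun := fun α => hamBilin (covOpₗ α) D D
      map_add' := fun α β => by
        simp only [hamBilin, LinearMap.mk₂_apply, map_add, mul_add, add_mul, map_sub]; abel
      map_smul' := fun c α => by
        simp only [hamBilin, LinearMap.mk₂_apply, map_smul, mul_smul_comm, smul_mul_assoc,
          map_sub, smul_sub, RingHom.id_apply] }

lemma hamMap_apply (D : DO N m) (α : DO N m →L[ℝ] ℝ) :
    hamMap D α = hamBilin (covOpₗ α) D D := rfl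

lemma toOp_hamMap (D : DO N m) (α : DO N m →L[ℝ] ℝ) :
    toOp (hamMap D α) = hamOp (toOp D) (covOpₗ α) :=
  toOp_coeffsₗ (hamOp_mem (toOp_mem D) _)

lemma contDiff_hamMap : ContDiff ℝ ∞ (hamMap : DO N m → (DO N m →L[ℝ] ℝ) →L[ℝ] DO N m) :=
  contDiff_clm_apply_iff.2 fun α => (contDiff_and_fderiv_diagonal (hamBilin (covOpₗ α))).1

lemma fderiv_hamMap_apply (D X : DO N m) (α : DO N m →L[ℝ] ℝ) :
    fderiv ℝ hamMap D X α = hamBilin (covOpₗ α) D X + hamBilin (covOpₗ α) X D := by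
  have h := (contDiff_and_fderiv_diagonal (hamBilin (m := m) (covOpₗ α))).2 D X
  rw [← h]
  have h' : (fun x => hamBilin (covOpₗ α) x x) = fun x => hamMap x α := rfl
  rw [h', fderiv_clm_apply (contDiff_hamMap.differentiable (by simp) D)
    (differentiableAt_const α)]
  simp

lemma quadTensor_eq (D V W : Op N) : quadTensor D V W = sumTrₗ (hamOp D V * W) := rfl

lemma apply_hamMap (D : DO N m) (α β : DO N m →L[ℝ] ℝ) :
    β (hamMap D α) = quadTensor (toOp D) (covOpₗ α) (covOpₗ β) := by
  rw [quadTensor_eq, ← sumTr_covOpₗ_mul, toOp_hamMap, sumTr_mul_comm]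

lemma quadTensor_eq_sumTr (D V W : Op N) :
    quadTensor D V W = sumTrₗ (rMatₗ (D * V) * (D * W)) - sumTrₗ (rMatₗ (V * D) * (W * D)) := by
  rw [quadTensor_eq, hamOp, sub_mul, map_sub, mul_assoc, mul_assoc, sumTr_mul_comm D, mul_assoc]
  rfl

lemma quadTensor_skew (D V W : Op N) : quadTensor D V W = -quadTensor D W V := by
  rw [quadTensor_eq_sumTr, quadTensor_eq_sumTr, sumTr_rMat_mul, sumTr_rMat_mul,
    sumTr_mul_comm _ (rMatₗ _), sumTr_mul_comm _ (rMatₗ _)]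
  ring

lemma isPoissonBracket_bracket1 :
    IsPoissonBracket (bracket1 : (DO N m → ℝ) → (DO N m → ℝ) → DO N m → ℝ) := by
  have h : (bracket1 : (DO N m → ℝ) → (DO N m → ℝ) → DO N m → ℝ) =
      fun F G D => fderiv ℝ G D (hamMap D (fderiv ℝ F D)) := by
    funext F G D
    rw [apply_hamMap]; rfl
  rw [h]
  refine isPoissonBracket_of_bivector (hamMap (N := N) (m := m)) contDiff_hamMap (fun D α β => ?_)
    fun D α β γ => ?_
  · rw [apply_hamMap, apply_hamMap, quadTensor_skew]
  · -- the derivative of the tensor along a Hamiltonian vector field, in the form of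
    -- `sklyanin_jacobi`
    have key : ∀ α β γ : DO N m →L[ℝ] ℝ, γ (fderiv ℝ hamMap D (hamMap D α) β) =
        sumTrₗ ((rMatₗ (hamOp (toOp D) (covOpₗ α) * covOpₗ β) * toOp D +
          rMatₗ (toOp D * covOpₗ β) * hamOp (toOp D) (covOpₗ α) -
          hamOp (toOp D) (covOpₗ α) * rMatₗ (covOpₗ β * toOp D) -
          toOp D * rMatₗ (covOpₗ β * hamOp (toOp D) (covOpₗ α))) * covOpₗ γ) := by
      intro α β γ
      set X := hamMap D α with hX
      have hX' : toOp X = hamOp (toOp D) (covOpₗ α) := toOp_hamMap D α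
      have e : toOp (fderiv ℝ hamMap D X β) =
          rMatₗ (toOp X * covOpₗ β) * toOp D + rMatₗ (toOp D * covOpₗ β) * toOp X -
            toOp X * rMatₗ (covOpₗ β * toOp D) - toOp D * rMatₗ (covOpₗ β * toOp X) := by
        -- polarization of `hamOp` along the line through `D` and `X`
        have p := toOp_hamMap (D + X) β
        have p₀ := toOp_hamMap D β
        have p₁ := toOp_hamMap X β
        simp only [hamMap_apply, ← toOpₗ_apply, ← rMatₗ_apply, hamOp, map_add,
          LinearMap.add_apply, add_mul, mul_add] at p p₀ p₁
        rw [p₀, p₁] at p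
        rw [fderiv_hamMap_apply, ← toOpₗ_apply, map_add, ← toOpₗ_apply, ← toOpₗ_apply]
        have q := sub_eq_zero.2 p
        rw [← sub_eq_zero, ← q]
        abel
      rw [← sumTr_covOpₗ_mul, e, hX', sumTr_mul_comm]
    have j := sklyanin_jacobi sumTrₗ rMatₗ sumTr_mul_comm sumTr_rMat_mul sumTr_yangBaxter
      (toOp D) (covOpₗ α) (covOpₗ β) (covOpₗ γ) (hamOp (toOp D)) (fun _ => rfl) _
      (fun _ _ _ => rfl)
    rw [key, key, key]
    exact j

end Quadratic

/-! ### The companion bracket as a coefficient of the rescaled tensor -/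

section Pencil

variable {N m : ℕ}

lemma rMatₗ_of_mem_pos {L : Op N} (hL : L ∈ degIn N (Set.Ioi 0)) :
    rMatₗ L = (1 / 2 : ℝ) • L := by
  rw [rMatₗ_apply, rMat]
  congr 1
  ext k : 1
  rw [SkewMonoidAlgebra.coeff_sub, Finsupp.sub_apply, coeff_pos, coeff_neg_part]
  by_cases h : 0 < Multiplicative.toAdd k
  · simp [h, h.not_gt]
  · simp [hL k h]

lemma rMatₗ_of_mem_neg {L : Op N} (hL : L ∈ degIn N (Set.Iio 0)) :
    rMatₗ L = -(1 / 2 : ℝ) • L := by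
  rw [rMatₗ_apply, rMat, neg_smul, ← smul_neg]
  congr 1
  ext k : 1
  rw [SkewMonoidAlgebra.coeff_sub, Finsupp.sub_apply, coeff_pos, coeff_neg_part]
  by_cases h : Multiplicative.toAdd k < 0
  · simp [h, h.not_gt]
  · simp [hL k h]

lemma rMatₗ_of_mem_zer {L : Op N} (hL : L ∈ degIn N {0}) : rMatₗ L = 0 := by
  have h : pos L - neg L = 0 := by
    ext k : 1
    rw [SkewMonoidAlgebra.coeff_sub, Finsupp.sub_apply, coeff_pos, coeff_neg_part]
    by_cases h : Multiplicative.toAdd k = 0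
    · simp [h]
    · simp [hL k h]
  rw [rMatₗ_apply, rMat, h, smul_zero]

/-- Dependence of the quadratic bracket on the parameter of the scaling `φ`, for operators
`D = p + l z` and covectors `V = n + k v`, `k = l⁻¹`, split into terms of nonzero and of zero
degree: by cyclicity of the trace the coefficient of `k` vanishes, and that of `l` is the
companion bracket. -/
lemma quadTensor_scale [NeZero N] {p z n v n' v' : Op N} (hp : p ∈ degIn N (Set.Ioi 0))
    (hz : z ∈ degIn N {0}) (hn : n ∈ degIn N (Set.Iio 0)) (hv : v ∈ degIn N {0})
    (hn' : n' ∈ degIn N (Set.Iio 0)) (hv' : v' ∈ degIn N {0}) {l k : ℝ} (hlk : l * k = 1) :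
    quadTensor (p + l • z) (n + k • v) (n' + k • v') =
      (sumTrₗ (rMatₗ (p * n) * (p * n')) - sumTrₗ (rMatₗ (n * p) * (n' * p)) +
        (1 / 2) * (sumTrₗ (p * v * (z * n')) - sumTrₗ (z * n * (p * v')) -
          sumTrₗ (v * p * (n' * z)) + sumTrₗ (n * z * (v' * p)))) +
      l * (sumTrₗ (p * n * z * n') - sumTrₗ (p * n' * z * n)) := by
  have pz : ∀ {a b : Op N}, a ∈ degIn N (Set.Ioi 0) → b ∈ degIn N {0} →
      a * b ∈ degIn N (Set.Ioi 0) := fun ha hb =>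
    mul_mem_degIn (by rintro s hs t rfl; simpa using hs) ha hb
  have zp : ∀ {a b : Op N}, a ∈ degIn N {0} → b ∈ degIn N (Set.Ioi 0) →
      a * b ∈ degIn N (Set.Ioi 0) := fun ha hb =>
    mul_mem_degIn (by rintro s rfl t ht; simpa using ht) ha hb
  have nz : ∀ {a b : Op N}, a ∈ degIn N (Set.Iio 0) → b ∈ degIn N {0} →
      a * b ∈ degIn N (Set.Iio 0) := fun ha hb =>
    mul_mem_degIn (by rintro s hs t rfl; simpa using hs) ha hb
  have zn : ∀ {a b : Op N}, a ∈ degIn N {0} → b ∈ degIn N (Set.Iio 0) →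
      a * b ∈ degIn N (Set.Iio 0) := fun ha hb =>
    mul_mem_degIn (by rintro s rfl t ht; simpa using ht) ha hb
  have zz : ∀ {a b : Op N}, a ∈ degIn N {0} → b ∈ degIn N {0} → a * b ∈ degIn N {0} :=
    fun ha hb => mul_mem_degIn (by rintro s rfl t rfl; simp) ha hb
  have tp : ∀ {a b : Op N}, a ∈ degIn N (Set.Ioi 0) → b ∈ degIn N (Set.Ioi 0) →
      sumTrₗ (a * b) = 0 := fun ha hb => sumTr_eq_zero_of_mem_degIn (S := Set.Ioi 0) (by simp)
    (mul_mem_degIn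
      (fun s hs t ht => add_pos (Set.mem_Ioi.1 hs) (Set.mem_Ioi.1 ht)) ha hb)
  have tn : ∀ {a b : Op N}, a ∈ degIn N (Set.Iio 0) → b ∈ degIn N (Set.Iio 0) →
      sumTrₗ (a * b) = 0 := fun ha hb => sumTr_eq_zero_of_mem_degIn (S := Set.Iio 0) (by simp)
    (mul_mem_degIn
      (fun s hs t ht => add_neg (Set.mem_Iio.1 hs) (Set.mem_Iio.1 ht)) ha hb)
  have tpz : ∀ {a b : Op N}, a ∈ degIn N (Set.Ioi 0) → b ∈ degIn N {0} →
      sumTrₗ (a * b) = 0 := fun ha hb =>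
    sumTr_eq_zero_of_mem_degIn (S := Set.Ioi 0) (by simp) (pz ha hb)
  have tnz : ∀ {a b : Op N}, a ∈ degIn N (Set.Iio 0) → b ∈ degIn N {0} →
      sumTrₗ (a * b) = 0 := fun ha hb =>
    sumTr_eq_zero_of_mem_degIn (S := Set.Iio 0) (by simp) (nz ha hb)
  -- `r` in the first factor is moved to the second one when that has terms of one sign only
  have rp : ∀ a b : Op N, b ∈ degIn N (Set.Ioi 0) →
      sumTrₗ (rMatₗ a * b) = -(1 / 2) * sumTrₗ (a * b) := fun a b hb => by
    rw [sumTr_rMat_mul, rMatₗ_of_mem_pos hb, mul_smul_comm, map_smul, smul_eq_mul]; ring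
  have rn : ∀ a b : Op N, b ∈ degIn N (Set.Iio 0) →
      sumTrₗ (rMatₗ a * b) = (1 / 2) * sumTrₗ (a * b) := fun a b hb => by
    rw [sumTr_rMat_mul, rMatₗ_of_mem_neg hb, mul_smul_comm, map_smul, smul_eq_mul]; ring
  have rz : ∀ a b : Op N, b ∈ degIn N {0} → sumTrₗ (rMatₗ a * b) = 0 := fun a b hb => by
    rw [sumTr_rMat_mul, rMatₗ_of_mem_zer hb, mul_zero, map_zero, neg_zero]
  have exA : ∀ n v : Op N,
      (p + l • z) * (n + k • v) = p * n + k • (p * v) + l • (z * n) + z * v := by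
    intro n v
    simp only [add_mul, mul_add, smul_mul_assoc, mul_smul_comm, smul_add, smul_smul]
    rw [mul_comm k l, hlk, one_smul]; abel
  have exB : ∀ n v : Op N,
      (n + k • v) * (p + l • z) = n * p + k • (v * p) + l • (n * z) + v * z := by
    intro n v
    simp only [add_mul, mul_add, smul_mul_assoc, mul_smul_comm, smul_add, smul_smul]
    rw [hlk, one_smul]; abel
  have c1 := sumTr_mul_comm p (n * (p * v'))
  have c2 := sumTr_mul_comm p (v * (p * n'))
  have c3 := sumTr_mul_comm z (n * (p * n'))
  have c4 := sumTr_mul_comm (p * (n' * z)) n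
  have c5 := sumTr_mul_comm p (n * (z * n'))
  have c6 := sumTr_mul_comm (z * n) (p * n')
  rw [quadTensor_eq_sumTr, exA, exA, exB, exB]
  simp only [map_add, map_smul, rMatₗ_of_mem_pos (pz hp hv), rMatₗ_of_mem_neg (zn hz hn),
    rMatₗ_of_mem_zer (zz hz hv), rMatₗ_of_mem_pos (zp hv hp), rMatₗ_of_mem_neg (nz hn hz),
    rMatₗ_of_mem_zer (zz hv hz), add_mul, mul_add, smul_mul_assoc, mul_smul_comm, smul_eq_mul,
    zero_mul, map_zero, rp _ _ (pz hp hv'), rn _ _ (zn hz hn'), rz _ _ (zz hz hv'),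
    rp _ _ (zp hv' hp), rn _ _ (nz hn' hz), rz _ _ (zz hv' hz),
    tp (pz hp hv) (pz hp hv'), tn (zn hz hn) (zn hz hn'), tpz (pz hp hv) (zz hz hv'),
    tnz (zn hz hn) (zz hz hv'), tp (zp hv hp) (zp hv' hp), tn (nz hn hz) (nz hn' hz),
    tpz (zp hv hp) (zz hv' hz), tnz (nz hn hz) (zz hv' hz)]
  simp only [mul_assoc] at *
  linear_combination (-k / 2) * c1 + (k / 2) * c2 - (l / 2) * c6 - (l / 2) * c5 +
    (l / 2) * c4 + (1 / 2) *
    (sumTrₗ (p * (v * (z * n'))) - sumTrₗ (z * (n * (p * v'))) -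
          sumTrₗ (v * (p * (n' * z))) + sumTrₗ (n * (z * (v' * p)))) * hlk

lemma rPlus_eq (L : Op N) : rPlus L = pos L + (1 / 2 : ℝ) • zer L := rfl

lemma sumTr_rPlus_mul [NeZero N] (L : Op N) {M : Op N} (hM : M ∈ degIn N (Set.Iio 0)) :
    sumTrₗ (rPlus L * M) = sumTrₗ (L * M) := by
  have h1 : sumTrₗ (zer L * M) = 0 := sumTr_eq_zero_of_mem_degIn (S := Set.Iio 0) (by simp)
    (mul_mem_degIn (by rintro s rfl t ht; simpa using ht) (zer_mem L) hM)
  have h2 : sumTrₗ (neg L * M) = 0 := sumTr_eq_zero_of_mem_degIn (S := Set.Iio 0) (by simp)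
    (mul_mem_degIn
      (fun s hs t ht => add_neg (Set.mem_Iio.1 hs) (Set.mem_Iio.1 ht)) (neg_mem L) hM)
  conv_rhs => rw [← pos_add_zer_add_neg L]
  simp only [rPlus_eq, add_mul, smul_mul_assoc, map_add, map_smul, h1, h2, smul_zero, add_zero]

lemma sumTr_pos_mul [NeZero N] (L M : Op N) :
    sumTrₗ (pos L * M) = sumTrₗ (L * neg M) := by
  have h1 : sumTrₗ (pos L * pos M) = 0 := sumTr_eq_zero_of_mem_degIn (S := Set.Ioi 0) (by simp)
    (mul_mem_degIn
      (fun s hs t ht => add_pos (Set.mem_Ioi.1 hs) (Set.mem_Ioi.1 ht)) (pos_mem L) (pos_mem M))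
  have h2 : sumTrₗ (pos L * zer M) = 0 := sumTr_eq_zero_of_mem_degIn (S := Set.Ioi 0) (by simp)
    (mul_mem_degIn (by rintro s hs t rfl; simpa using hs) (pos_mem L)
      (zer_mem M))
  have h3 : sumTrₗ (zer L * neg M) = 0 := sumTr_eq_zero_of_mem_degIn (S := Set.Iio 0) (by simp)
    (mul_mem_degIn (by rintro s rfl t ht; simpa using ht) (zer_mem L)
      (neg_mem M))
  rw [← sumTr_rPlus_mul L (neg_mem M)]
  conv_lhs => rw [← pos_add_zer_add_neg M]
  simp only [rPlus_eq, add_mul, mul_add, smul_mul_assoc, map_add, map_smul, h1, h2, h3, smul_zero,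
    add_zero, zero_add]

/-- The companion bracket is of Lie–Poisson type: it pairs `D_+` with the commutator of `V_-` and
`W_-` for the product `(V, W) ↦ V D_0 W`. -/
lemma companionTensor_eq [NeZero N] (D V W : Op N) :
    companionTensor D V W = sumTrₗ (pos D * (neg V * zer D * neg W - neg W * zer D * neg V)) := by
  have h1 : zer D * neg W ∈ degIn N (Set.Iio 0) :=
    mul_mem_degIn (by rintro s rfl t ht; simpa using ht) (zer_mem D) (neg_mem W)
  have h2 : neg W * zer D ∈ degIn N (Set.Iio 0) :=
    mul_mem_degIn (by rintro s hs t rfl; simpa using hs) (neg_mem W) (zer_mem D)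
  rw [companionTensor, ← sumTrₗ_apply, map_sub, mul_assoc, mul_assoc, sumTr_rPlus_mul _ h1,
    sumTr_rPlus_mul _ h2, mul_sub, map_sub, mul_assoc (neg V) (pos D), sumTr_mul_comm (neg V)]
  simp only [mul_assoc]

lemma companionTensor_skew [NeZero N] (D V W : Op N) :
    companionTensor D V W = -companionTensor D W V := by
  rw [companionTensor_eq, companionTensor_eq, mul_sub, mul_sub, map_sub, map_sub, neg_sub]

/-- For a constant term `D_0 = c` the companion bracket is linear in `D_+`. -/
lemma companionTensor_eq_linear [NeZero N] (D V W : Op N) (c : ℝ) (hD : zer D = c • 1) :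
    companionTensor D V W = c * sumTr (pos (pos D * neg V - neg V * pos D) * W) := by
  rw [companionTensor_eq, hD, ← sumTrₗ_apply, sumTr_pos_mul (_ - _) W]
  have h := sumTr_mul_comm (neg V) (pos D * neg W)
  simp only [mul_sub, sub_mul, mul_smul_comm, smul_mul_assoc, mul_one, map_sub, map_smul,
    smul_eq_mul, mul_assoc] at h ⊢
  rw [h]

end Pencil

/-! ### The pencil -/

section Scaling

variable {N m : ℕ}

lemma coeff_dualOp (v : DO N m) (k : Multiplicative ℤ) :
    (dualOp v).coeff k =
      ∑ i : Fin (m + 1), if Multiplicative.toAdd k = -(i : ℤ) then k • v i else 0 := by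
  classical
  rw [dualOp, coeff_finset_sum]
  refine Finset.sum_congr rfl fun i _ => ?_
  rw [mulOp, shift, SkewMonoidAlgebra.single_mul_single, mul_one, one_mul,
    SkewMonoidAlgebra.coeff_single_apply]
  by_cases h : Multiplicative.toAdd k = -(i : ℤ)
  · have h' : Multiplicative.ofAdd (-(i : ℤ)) = k := by rw [← h]; rfl
    rw [if_pos h, if_pos h', h']
  · rw [if_neg h, if_neg fun h' => h (by rw [← h']; rfl)]

/-- Rescaling the coefficient of index `0`. -/
def scaleZero (c : ℝ) (a : DO N m) : DO N m := fun i => if i = 0 then c • a i else a i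

lemma toOp_scaleZero (c : ℝ) (a : DO N m) :
    toOp (scaleZero c a) = pos (toOp a) + c • zer (toOp a) := by
  ext k : 1
  rw [SkewMonoidAlgebra.coeff_add, SkewMonoidAlgebra.coeff_smul, Finsupp.add_apply,
    Finsupp.smul_apply, coeff_pos, coeff_zer, coeff_toOp, coeff_toOp]
  have h1 : k = 1 ↔ Multiplicative.toAdd k = 0 := Iff.rfl
  simp only [h1, scaleZero, Fin.ext_iff, Fin.val_zero]
  rcases lt_trichotomy (Multiplicative.toAdd k) 0 with h | h | h
  · rw [if_neg h.not_gt, if_neg h.ne, smul_zero, add_zero]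
    exact Finset.sum_eq_zero fun i _ => if_neg (by omega)
  · rw [h, if_neg (lt_irrefl _), if_pos rfl, zero_add, Finset.smul_sum]
    refine Finset.sum_congr rfl fun i _ => ?_
    by_cases hi : (i : ℕ) = 0
    · simp [hi]
    · rw [if_neg (by omega), if_neg (by omega), smul_zero]
  · rw [if_pos h, if_neg h.ne', smul_zero, add_zero]
    refine Finset.sum_congr rfl fun i _ => ?_
    by_cases hi : (i : ℕ) = 0
    · rw [if_neg (by omega), if_neg (by omega)]
    · rw [if_neg hi]

lemma dualOp_scaleZero (c : ℝ) (v : DO N m) :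
    dualOp (scaleZero c v) = neg (dualOp v) + c • zer (dualOp v) := by
  ext k : 1
  rw [SkewMonoidAlgebra.coeff_add, SkewMonoidAlgebra.coeff_smul, Finsupp.add_apply,
    Finsupp.smul_apply, coeff_neg_part, coeff_zer, coeff_dualOp, coeff_dualOp]
  have h1 : k = 1 ↔ Multiplicative.toAdd k = 0 := Iff.rfl
  simp only [h1, scaleZero, Fin.ext_iff, Fin.val_zero]
  rcases lt_trichotomy (Multiplicative.toAdd k) 0 with h | h | h
  · rw [if_pos h, if_neg h.ne, smul_zero, add_zero]
    refine Finset.sum_congr rfl fun i _ => ?_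
    by_cases hi : (i : ℕ) = 0
    · rw [if_neg (by omega), if_neg (by omega)]
    · rw [if_neg hi]
  · rw [if_neg (by omega), if_pos h, zero_add, Finset.smul_sum]
    refine Finset.sum_congr rfl fun i _ => ?_
    by_cases hi : (i : ℕ) = 0
    · simp [hi, h, smul_comm]
    · rw [if_neg (by omega), if_neg (by omega), smul_zero]
  · rw [if_neg h.not_gt, if_neg h.ne', smul_zero, add_zero]
    exact Finset.sum_eq_zero fun i _ => if_neg (by omega)

lemma zer_toOp (D : DO N m) : zer (toOp D) = mulOp (D 0) := by
  rw [zer, coeff_toOp]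
  congr 1
  rw [Finset.sum_eq_single 0]
  · simp
  · intro i _ hi
    refine if_neg fun h => hi (Fin.ext ?_)
    have h' : (0 : ℤ) = (i : ℕ) := h
    simpa using h'.symm
  · simp

variable [NeZero N]

/-- `φ_λ` as a continuous linear isomorphism. -/
def phiL (N m : ℕ) [NeZero N] (l : ℝˣ) : DO N m ≃L[ℝ] DO N m :=
  LinearEquiv.toContinuousLinearEquiv
    { phi N m l with
      map_add' := fun a b => by
        funext i
        by_cases h : i = 0 <;> simp [phi, h]
      map_smul' := fun c a => by
        funext i
        by_cases h : i = 0 <;> simp [phi, h, smul_comm c] }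

lemma grad_comp_phi (l : ℝˣ) (F : DO N m → ℝ) (D : DO N m) :
    grad (F ∘ phi N m l) ((phi N m l).symm D) =
      dualOp (scaleZero ((l⁻¹ : ℝˣ) : ℝ)
        fun i n => fderiv ℝ F D (Pi.single i (Pi.single n 1))) := by
  have h : fderiv ℝ (F ∘ phi N m l) ((phi N m l).symm D) =
      (fderiv ℝ F D).comp (phiL N m l : DO N m →L[ℝ] DO N m) := by
    have h' := (phiL N m l).comp_right_fderiv (f := F) (x := (phi N m l).symm D)
    rw [show phiL N m l ((phi N m l).symm D) = D from (phi N m l).apply_symm_apply D] at h'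
    exact h'
  rw [grad, h]
  congr 1
  funext i n
  have e : phi N m l (Pi.single i (Pi.single n 1)) =
      (if i = 0 then ((l⁻¹ : ℝˣ) : ℝ) else 1) •
        (Pi.single i (Pi.single n 1) : DO N m) := by
    funext j
    by_cases hj : j = i
    · subst hj
      by_cases h0 : j = 0 <;> simp [phi, h0]
    · by_cases h0 : j = 0 <;> simp [phi, h0, hj]
      simp [← h0, hj]
  change fderiv ℝ F D (phi N m l (Pi.single i (Pi.single n 1))) = _
  rw [e, map_smul]
  by_cases h0 : i = 0 <;> simp [scaleZero, h0]

lemma isPoissonBracket_pencil (l : ℝˣ) : IsPoissonBracket (pencil (N := N) (m := m) l) :=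
  isPoissonBracket_bracket1.map (phiL N m l)

/-- The pencil is affine in the parameter, with the companion bracket as its slope. -/
lemma pencil_eq (l : ℝˣ) (F G : DO N m → ℝ) (D : DO N m) :
    pencil l F G D = pencil 1 F G D + ((l : ℝ) - 1) * bracket2 F G D := by
  have key : ∀ k : ℝˣ, pencil k F G D =
      quadTensor (pos (toOp D) + (k : ℝ) • zer (toOp D))
        (neg (grad F D) + ((k⁻¹ : ℝˣ) : ℝ) • zer (grad F D))
        (neg (grad G D) + ((k⁻¹ : ℝˣ) : ℝ) • zer (grad G D)) := by
    intro k
    have e : (phi N m k).symm D = scaleZero (k : ℝ) D := rfl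
    rw [pencil, bracket1, grad_comp_phi, grad_comp_phi, e, toOp_scaleZero, dualOp_scaleZero,
      dualOp_scaleZero]
    rfl
  rw [key l, key 1,
    quadTensor_scale (pos_mem _) (zer_mem _) (neg_mem _) (zer_mem _) (neg_mem _) (zer_mem _)
      l.mul_inv,
    quadTensor_scale (pos_mem _) (zer_mem _) (neg_mem _) (zer_mem _) (neg_mem _) (zer_mem _)
      (1 : ℝˣ).mul_inv,
    bracket2, companionTensor_eq, Units.val_one]
  simp only [mul_sub, map_sub, mul_assoc]
  ring

/-- The bracket with parameter `3` is a combination of those with parameters `1` and `2`, so these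
two are compatible; the companion bracket is their difference. -/
lemma isPoissonBracket_combination (s t : ℝ) :
    IsPoissonBracket (E := DO N m)
      fun F G D => s * (pencil 1 F G D - bracket2 F G D) + t * bracket2 F G D := by
  set two : ℝˣ := Units.mk0 2 two_ne_zero
  set three : ℝˣ := Units.mk0 3 three_ne_zero
  have h3 : IsPoissonBracket (E := DO N m)
      fun F G => (-1 : ℝ) • pencil 1 F G + (2 : ℝ) • pencil two F G := by
    convert isPoissonBracket_pencil (N := N) (m := m) three using 3 with F G
    funext D
    simp only [Pi.add_apply, Pi.smul_apply, smul_eq_mul]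
    rw [pencil_eq two, pencil_eq three]
    simp only [two, three, Units.val_mk0]
    ring
  convert (isPoissonBracket_pencil (N := N) (m := m) 1).combination
    (isPoissonBracket_pencil two) (by norm_num) (by norm_num) h3 (2 * s - t) (t - s)
    using 3 with F G
  funext D
  simp only [Pi.add_apply, Pi.smul_apply, smul_eq_mul]
  rw [pencil_eq two]
  simp only [two, Units.val_mk0]
  ring

lemma isPoissonBracket_bracket2 :
    IsPoissonBracket (bracket2 : (DO N m → ℝ) → (DO N m → ℝ) → DO N m → ℝ) := by
  convert isPoissonBracket_combination (N := N) (m := m) 0 1 using 4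
  ring

lemma companionTensor_eq_linearTensor (D : DO N m) (hD : D 0 = fun _ => (-1) ^ (m - 1))
    (V W : Op N) : companionTensor (toOp D) V W = linearTensor m (toOp D) V W := by
  refine companionTensor_eq_linear _ V W ((-1) ^ (m - 1)) ?_
  rw [zer_toOp, hD, mulOp, SkewMonoidAlgebra.one_def, SkewMonoidAlgebra.smul_single]
  congr 1
  funext n
  simp

end Scaling

/-! ### The reduced bracket on the slice -/

section Reduction

variable {N m : ℕ}

/-- The projection `(a^0, …, a^m) ↦ (a^1, …, a^{m-1})`. -/
def sliceProj : DO N m →L[ℝ] Slice N m :=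
  ContinuousLinearMap.pi fun j => ContinuousLinearMap.proj ⟨(j : ℕ) + 1, by omega⟩

lemma sliceProj_apply (D : DO N m) (j : Fin (m - 1)) :
    sliceProj D j = D ⟨(j : ℕ) + 1, by omega⟩ := rfl

lemma sliceProj_sliceOp (a : Slice N m) : sliceProj (sliceOp a) = a := by
  funext j
  rw [sliceProj_apply, sliceOp]
  have := j.isLt
  rw [dif_neg (by simp), dif_neg (by simp; omega)]
  rfl

lemma sliceOp_zero (a : Slice N m) : sliceOp a 0 = fun _ => (-1) ^ (m - 1) := by
  rw [sliceOp]; simp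

variable [NeZero N]

lemma contDiff_sliceProj : ContDiff ℝ ∞ (sliceProj : DO N m → Slice N m) :=
  ContinuousLinearMap.contDiff (sliceProj : DO N m →L[ℝ] Slice N m)

/-- The inclusion of the tangent space of the slice: `a^1, …, a^{m-1}`, extended by zero. -/
def sliceLin : Slice N m →L[ℝ] DO N m :=
  LinearMap.toContinuousLinearMap
    { toFun := fun a i => if h : (i : ℕ) = 0 ∨ (i : ℕ) = m then 0
        else a ⟨(i : ℕ) - 1, by have := i.isLt; omega⟩
      map_add' := fun a b => by
        funext i
        by_cases h : (i : ℕ) = 0 ∨ (i : ℕ) = m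
        · simp only [Pi.add_apply, dif_pos h, add_zero]
        · simp only [Pi.add_apply, dif_neg h]
      map_smul' := fun c a => by
        funext i
        by_cases h : (i : ℕ) = 0 ∨ (i : ℕ) = m
        · simp only [Pi.smul_apply, dif_pos h, smul_zero, RingHom.id_apply]
        · simp only [Pi.smul_apply, dif_neg h, RingHom.id_apply] }

lemma sliceLin_apply (a : Slice N m) (i : Fin (m + 1)) :
    sliceLin a i = if h : (i : ℕ) = 0 ∨ (i : ℕ) = m then 0
      else a ⟨(i : ℕ) - 1, by have := i.isLt; omega⟩ := rfl

lemma sliceOp_eq (a : Slice N m) : sliceOp a = sliceOp 0 + sliceLin a := by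
  funext i
  rw [Pi.add_apply, sliceLin_apply, sliceOp, sliceOp]
  by_cases h0 : (i : ℕ) = 0
  · simp [h0]
  · by_cases hm : (i : ℕ) = m
    · simp [hm]
    · simp [h0, hm]

lemma hasFDerivAt_sliceOp (a : Slice N m) :
    HasFDerivAt (sliceOp : Slice N m → DO N m) sliceLin a := by
  have h : (sliceOp : Slice N m → DO N m) = fun a => sliceOp 0 + sliceLin a :=
    funext sliceOp_eq
  rw [h]
  exact (sliceLin.hasFDerivAt).const_add _

lemma contDiff_sliceOp : ContDiff ℝ ∞ (sliceOp : Slice N m → DO N m) := by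
  have h : (sliceOp : Slice N m → DO N m) = fun a => sliceOp 0 + sliceLin a :=
    funext sliceOp_eq
  rw [h]
  exact contDiff_const.add (ContinuousLinearMap.contDiff (sliceLin : Slice N m →L[ℝ] DO N m))

/-- The terms `v^0` and `𝒯^{-m} v^m` of `V` do not contribute to the companion bracket: the
first is not part of `V_-`, and `V_- D_0 W_-` has too low a degree to pair with `D_+` when `V_-`
has degree `-m`. -/
lemma companionTensor_eq_zero (D : DO N m) (v : DO N m)
    (hv : ∀ i : Fin (m + 1), (i : ℕ) ≠ 0 → (i : ℕ) ≠ m → v i = 0) (W : Op N) :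
    companionTensor (toOp D) (dualOp v) W = 0 := by
  have hn : neg (dualOp v) ∈ degIn N (Set.Iic (-(m : ℤ))) := by
    intro k hk
    rw [coeff_neg_part]
    split_ifs with h
    · rw [coeff_dualOp]
      refine Finset.sum_eq_zero fun i _ => ?_
      split_ifs with hi
      · rw [hv i (by omega) fun h' => hk (by rw [hi, h']; exact le_refl (-(m : ℤ))), smul_zero]
      · rfl
    · rfl
  have hp : pos (toOp D) ∈ degIn N (Set.Iic (m : ℤ)) := by
    intro k hk
    rw [coeff_pos]
    split_ifs with h
    · exact toOp_mem D k fun h' => hk h'.2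
    · rfl
  have low : ∀ s ∈ Set.Iic (-(m : ℤ)), ∀ t ∈ Set.Iio (0 : ℤ), s + t ∈ Set.Iio (-(m : ℤ)) := by
    intro s hs t ht
    simp only [Set.mem_Iic, Set.mem_Iio] at *
    omega
  have h1 : neg (dualOp v) * zer (toOp D) * neg W ∈ degIn N (Set.Iio (-(m : ℤ))) :=
    mul_mem_degIn low
      (mul_mem_degIn (by rintro s hs t rfl; simpa using hs) hn (zer_mem _)) (neg_mem W)
  have h2 : neg W * zer (toOp D) * neg (dualOp v) ∈ degIn N (Set.Iio (-(m : ℤ))) :=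
    mul_mem_degIn (fun s hs t ht => by rw [add_comm]; exact low t ht s hs)
      (mul_mem_degIn (by rintro s hs t rfl; simpa using hs) (neg_mem W) (zer_mem _)) hn
  rw [companionTensor_eq]
  refine sumTr_eq_zero_of_mem_degIn (S := Set.Iio 0) (by simp)
    (mul_mem_degIn ?_ hp (sub_mem h1 h2))
  intro s hs t ht
  simp only [Set.mem_Iic, Set.mem_Iio] at *
  omega

lemma companionTensor_sub_left (D V V' W : Op N) :
    companionTensor D (V - V') W = companionTensor D V W - companionTensor D V' W := by
  have h : neg (V - V') = neg V - neg V' := map_sub negₗ V V'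
  simp only [companionTensor_eq, h, mul_sub, sub_mul, map_sub]
  ring

lemma companionTensor_congr_left (D : DO N m) (α β : DO N m →L[ℝ] ℝ)
    (h : α.comp sliceLin = β.comp sliceLin) (W : Op N) :
    companionTensor (toOp D) (covOpₗ α) W = companionTensor (toOp D) (covOpₗ β) W := by
  rw [← sub_eq_zero, ← companionTensor_sub_left, ← map_sub]
  refine companionTensor_eq_zero D _ (fun i h0 hm => ?_) W
  funext n
  have hi : (Pi.single i (Pi.single n 1) : DO N m) =
      sliceLin (Pi.single (⟨(i : ℕ) - 1, by have := i.isLt; omega⟩ : Fin (m - 1))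
        (Pi.single n 1)) := by
    funext j
    rw [sliceLin_apply]
    by_cases hj : j = i
    · subst hj
      simp [h0, hm]
    · have hj' : (j : ℕ) ≠ i := fun h => hj (Fin.ext h)
      rw [Pi.single_eq_of_ne hj]
      split_ifs with h
      · rfl
      · rw [Pi.single_eq_of_ne]
        intro h'
        have := congrArg Fin.val h'
        simp only at this
        omega
  change (α - β) (Pi.single i (Pi.single n 1)) = 0
  rw [hi]
  have := congrArg (fun γ : Slice N m →L[ℝ] ℝ => γ (Pi.single
    (⟨(i : ℕ) - 1, by have := i.isLt; omega⟩ : Fin (m - 1)) (Pi.single n 1))) h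
  simpa [sub_eq_zero] using this

/-- On the slice the companion bracket depends only on the restrictions of the functions to the
slice: `a^0` and `a^m` are Casimir functions. -/
lemma bracket2_congr {F F' G G' : DO N m → ℝ} {a : Slice N m}
    (hF : DifferentiableAt ℝ F (sliceOp a)) (hF' : DifferentiableAt ℝ F' (sliceOp a))
    (hG : DifferentiableAt ℝ G (sliceOp a)) (hG' : DifferentiableAt ℝ G' (sliceOp a))
    (h : ∀ b, F (sliceOp b) = F' (sliceOp b)) (h' : ∀ b, G (sliceOp b) = G' (sliceOp b)) :
    bracket2 F G (sliceOp a) = bracket2 F' G' (sliceOp a) := by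
  have key : ∀ K K' : DO N m → ℝ, DifferentiableAt ℝ K (sliceOp a) →
      DifferentiableAt ℝ K' (sliceOp a) → (∀ b, K (sliceOp b) = K' (sliceOp b)) →
      (fderiv ℝ K (sliceOp a)).comp sliceLin = (fderiv ℝ K' (sliceOp a)).comp sliceLin := by
    intro K K' hK hK' hKK'
    have h1 := hK.hasFDerivAt.comp a (hasFDerivAt_sliceOp a)
    have h2 := hK'.hasFDerivAt.comp a (hasFDerivAt_sliceOp a)
    have e : K ∘ sliceOp = K' ∘ sliceOp := funext hKK'
    rw [e] at h1
    exact h1.unique h2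
  rw [bracket2, bracket2, ← covOpₗ_fderiv, ← covOpₗ_fderiv, ← covOpₗ_fderiv, ← covOpₗ_fderiv,
    companionTensor_congr_left _ _ _ (key F F' hF hF' h), companionTensor_skew,
    companionTensor_congr_left _ _ _ (key G G' hG hG' h'), ← companionTensor_skew]

/-- The companion bracket of functions of `(a^1, …, a^{m-1})`, at the operators of the slice. -/
def sliceBracket (f g : Slice N m → ℝ) (a : Slice N m) : ℝ :=
  bracket2 (f ∘ sliceProj) (g ∘ sliceProj) (sliceOp a)

lemma isPoissonBracket_sliceBracket :
    IsPoissonBracket (sliceBracket : (Slice N m → ℝ) → (Slice N m → ℝ) → Slice N m → ℝ) := by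
  have hB := isPoissonBracket_bracket2 (N := N) (m := m)
  have hc : ∀ {f : Slice N m → ℝ}, ContDiff ℝ ∞ f → ContDiff ℝ ∞ (f ∘ sliceProj : DO N m → ℝ) :=
    fun hf => hf.comp contDiff_sliceProj
  have jac : ∀ f g h : Slice N m → ℝ, ContDiff ℝ ∞ f → ContDiff ℝ ∞ g → ContDiff ℝ ∞ h → ∀ a,
      sliceBracket f (sliceBracket g h) a =
        bracket2 (f ∘ sliceProj) (bracket2 (g ∘ sliceProj) (h ∘ sliceProj)) (sliceOp a) := by
    intro f g h hf hg hh a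
    have hK := hB.smooth _ _ (hc hg) (hc hh)
    have hK' : ContDiff ℝ ∞ (sliceBracket g h ∘ sliceProj : DO N m → ℝ) :=
      (hK.comp contDiff_sliceOp).comp contDiff_sliceProj
    refine bracket2_congr ((hc hf).differentiable (by simp) _)
      ((hc hf).differentiable (by simp) _) (hK'.differentiable (by simp) _)
      (hK.differentiable (by simp) _) (fun _ => rfl) fun b => ?_
    rw [Function.comp_apply, sliceProj_sliceOp]
    rfl
  refine ⟨?_, ?_, ?_, ?_, ?_, ?_⟩
  · intro f g hf hg
    exact (hB.smooth _ _ (hc hf) (hc hg)).comp contDiff_sliceOp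
  · intro f g h hf hg hh
    funext a
    exact congrFun (hB.add_left _ _ _ (hc hf) (hc hg) (hc hh)) _
  · intro c f g hf hg
    funext a
    exact congrFun (hB.smul_left c _ _ (hc hf) (hc hg)) _
  · intro f g hf hg
    funext a
    exact congrFun (hB.skew _ _ (hc hf) (hc hg)) _
  · intro f g h hf hg hh
    funext a
    have := congrFun (hB.leibniz _ _ _ (hc hf) (hc hg) (hc hh)) (sliceOp a)
    simp only [Pi.add_apply, Pi.mul_apply, Function.comp_apply, sliceProj_sliceOp] at this
    exact this
  · intro f g h hf hg hh
    funext a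
    have := congrFun (hB.jacobi _ _ _ (hc hf) (hc hg) (hc hh)) (sliceOp a)
    simp only [Pi.add_apply, Pi.zero_apply] at this ⊢
    rw [jac f g h hf hg hh, jac g h f hg hh hf, jac h f g hh hf hg, this]

lemma sliceBracket_eq {f g : Slice N m → ℝ} (hf : ContDiff ℝ ∞ f) (hg : ContDiff ℝ ∞ g)
    {F G : DO N m → ℝ} (hF : IsInvariantExtension f F) (hG : IsInvariantExtension g G)
    (a : Slice N m) : sliceBracket f g a = bracket2 F G (sliceOp a) := by
  refine bracket2_congr ((hf.comp contDiff_sliceProj).differentiable (by simp) _)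
    ((hF.smooth a).differentiableAt (by simp))
    ((hg.comp contDiff_sliceProj).differentiable (by simp) _)
    ((hG.smooth a).differentiableAt (by simp)) (fun b => ?_) fun b => ?_
  · rw [Function.comp_apply, sliceProj_sliceOp, hF.extends_f]
  · rw [Function.comp_apply, sliceProj_sliceOp, hG.extends_f]

/-- The reduced bracket of linear functions is affine: their extensions by `sliceProj` have
constant variational derivatives. -/
lemma sliceBracket_linear (f g : Slice N m →L[ℝ] ℝ) :
    ∃ (u : Slice N m →L[ℝ] ℝ) (c : ℝ), ∀ a, sliceBracket f g a = u a + c := by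
  set V : Op N := covOpₗ (f.comp sliceProj : DO N m →L[ℝ] ℝ) with hV
  set W : Op N := covOpₗ (g.comp sliceProj : DO N m →L[ℝ] ℝ) with hW
  have hfg : ∀ a, sliceBracket f g a = linearTensor m (toOp (sliceOp a)) V W := by
    intro a
    have e : ∀ h : Slice N m →L[ℝ] ℝ, fderiv ℝ (h ∘ sliceProj) (sliceOp a) = h.comp sliceProj :=
      fun h => (h.comp sliceProj).fderiv
    rw [sliceBracket, bracket2, companionTensor_eq_linearTensor _ (sliceOp_zero a),
      ← covOpₗ_fderiv, ← covOpₗ_fderiv, e, e]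
  let T : DO N m →ₗ[ℝ] ℝ :=
    { toFun := fun D => linearTensor m (toOp D) V W
      map_add' := fun D D' => by
        have h (D : DO N m) : linearTensor m (toOp D) V W = (-1) ^ (m - 1) *
          sumTrₗ (posₗ (posₗ (toOpₗ D) * neg V - neg V * posₗ (toOpₗ D)) * W) := rfl
        rw [h, h, h]
        simp only [map_add, add_mul, mul_add, map_sub, sub_mul]
        ring
      map_smul' := fun c D => by
        have h (D : DO N m) : linearTensor m (toOp D) V W = (-1) ^ (m - 1) *
          sumTrₗ (posₗ (posₗ (toOpₗ D) * neg V - neg V * posₗ (toOpₗ D)) * W) := rfl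
        rw [h, h]
        simp only [map_smul, smul_mul_assoc, mul_smul_comm, map_sub, sub_mul, smul_eq_mul,
          RingHom.id_apply]
        ring }
  refine ⟨(LinearMap.toContinuousLinearMap T).comp sliceLin, T (sliceOp 0), fun a => ?_⟩
  rw [hfg, sliceOp_eq, add_comm]
  exact map_add T _ _

end Reduction

/-! ### Gauge-invariant extensions -/

section Extension

variable {N m : ℕ}

/-- The operator `q ↦ q + 𝒯 q + ⋯ + 𝒯^{m-1} q` on periodic sequences. -/
def windowSum (N m : ℕ) : Seq N →ₗ[ℝ] Seq N where
  toFun q n := ∑ j ∈ Finset.range m, q (n + (j : ZMod N))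
  map_add' q q' := by funext n; simp [Finset.sum_add_distrib]
  map_smul' c q := by funext n; simp [Finset.mul_sum]

lemma windowSum_apply (q : Seq N) (n : ZMod N) :
    windowSum N m q n = ∑ j ∈ Finset.range m, q (n + (j : ZMod N)) := rfl

/-- A sequence in the kernel of `1 + 𝒯 + ⋯ + 𝒯^{m-1}` is fixed by `𝒯^m`, hence constant, since
`m` is prime to the period; so it vanishes. -/
lemma windowSum_injective [NeZero N] (hm : 1 ≤ m) (hNm : Nat.Coprime N m) :
    Function.Injective (windowSum N m) := by
  refine (injective_iff_map_eq_zero _).2 fun q hq => ?_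
  have h0 : ∀ n, ∑ j ∈ Finset.range m, q (n + (j : ZMod N)) = 0 := fun n => congrFun hq n
  have hper : ∀ n : ZMod N, q (n + (m : ZMod N)) = q n := by
    intro n
    have h1 := Finset.sum_range_succ (fun j : ℕ => q (n + (j : ZMod N))) m
    have h2 := Finset.sum_range_succ' (fun j : ℕ => q (n + (j : ZMod N))) m
    have h3 := h0 (n + 1)
    have e : ∀ j : ℕ, q (n + ((j + 1 : ℕ) : ZMod N)) = q (n + 1 + (j : ZMod N)) := fun j => by
      congr 1; push_cast; ring
    simp only [e, h3, Nat.cast_zero, add_zero] at h2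
    rw [h0 n, h2] at h1
    linarith
  have hmul : ∀ t : ℕ, q ((t : ZMod N) * (m : ZMod N)) = q 0 := by
    intro t
    induction t with
    | zero => simp
    | succ t ih => rw [← ih, ← hper (t * m)]; congr 1; push_cast; ring
  have hconst : ∀ n, q n = q 0 := by
    intro n
    have h := hmul (n * (m : ZMod N)⁻¹).val
    rw [ZMod.natCast_zmod_val, mul_assoc, mul_comm (m : ZMod N)⁻¹,
      ZMod.coe_mul_inv_eq_one m hNm.symm, mul_one] at h
    exact h
  funext n
  have h := h0 n
  simp only [hconst (n + _), Finset.sum_const, Finset.card_range, nsmul_eq_mul] at h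
  rw [hconst n]
  have hm' : (m : ℝ) ≠ 0 := by positivity
  exact (mul_eq_zero.1 h).resolve_left hm'

lemma gauge_apply (s p : Seq N) (L : DO N m) (k : Fin (m + 1)) (n : ZMod N) :
    gauge s p L k n = s n * L k n * ∏ j ∈ Finset.range (k : ℕ), p (n + (j : ZMod N)) := by
  simp [gauge, Finset.prod_apply, shiftAction_apply]

/-- The operators that can be brought to the slice by a positive gauge transformation: those with
`(-1)^{m-1} a^0 > 0` and `a^m < 0`. -/
def gaugeDomain (N m : ℕ) : Set (DO N m) :=
  {L | ∀ n, 0 < (-1) ^ (m - 1) * L 0 n ∧ L (Fin.last m) n < 0}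

lemma gauge_mem_gaugeDomain {s p : Seq N} (hs : ∀ n, 0 < s n) (hp : ∀ n, 0 < p n) (L : DO N m) :
    gauge s p L ∈ gaugeDomain N m ↔ L ∈ gaugeDomain N m := by
  refine forall_congr' fun n => and_congr ?_ ?_
  · rw [gauge_apply, Fin.val_zero, Finset.range_zero, Finset.prod_empty, mul_one, mul_left_comm,
      mul_pos_iff_of_pos_left (hs n)]
  · have hP : 0 < ∏ j ∈ Finset.range ((Fin.last m : Fin (m + 1)) : ℕ), p (n + (j : ZMod N)) :=
      Finset.prod_pos fun _ _ => hp _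
    rw [gauge_apply, ← neg_pos, mul_right_comm, ← mul_neg,
      mul_pos_iff_of_pos_left (mul_pos (hs n) hP), neg_pos]

lemma sliceOp_mem_gaugeDomain (hm : 1 ≤ m) (a : Slice N m) : sliceOp a ∈ gaugeDomain N m := by
  intro n
  constructor
  · rw [sliceOp_zero, ← mul_pow]; norm_num
  · have h : ((Fin.last m : Fin (m + 1)) : ℕ) ≠ 0 := by rw [Fin.val_last]; omega
    rw [sliceOp, dif_neg h, dif_pos (Fin.val_last m)]
    norm_num

variable [NeZero N]

lemma isOpen_gaugeDomain : IsOpen (gaugeDomain N m) := by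
  have h : gaugeDomain N m =
      ⋂ n, {L | 0 < (-1) ^ (m - 1) * L 0 n ∧ L (Fin.last m) n < 0} := by
    ext L; simp [gaugeDomain]
  rw [h]
  have hc : ∀ (k : Fin (m + 1)) (n : ZMod N), Continuous fun L : DO N m => L k n :=
    fun k n => by fun_prop
  exact isOpen_iInter_of_finite fun n =>
    (isOpen_lt continuous_const (continuous_const.mul (hc 0 n))).inter
      (isOpen_lt (hc _ n) continuous_const)

variable (hm : 1 ≤ m) (hNm : Nat.Coprime N m)

/-- The inverse of `1 + 𝒯 + ⋯ + 𝒯^{m-1}`. -/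
def windowInv : Seq N →ₗ[ℝ] Seq N :=
  (LinearEquiv.ofInjectiveEndo (windowSum N m) (windowSum_injective hm hNm)).symm.toLinearMap

lemma windowInv_windowSum (q : Seq N) : windowInv hm hNm (windowSum N m q) = q :=
  (LinearEquiv.ofInjectiveEndo (windowSum N m) (windowSum_injective hm hNm)).symm_apply_apply q

/-- The sequence `p = (𝒯 b) / b` of the gauge transformation that brings `L` to the slice. The
condition on the leading coefficient is `∏_{j < m} 𝒯^j p = (-1)^{m-1} a^0 / (-a^m)`, which is
solved by taking logarithms. -/
def normP (L : DO N m) : Seq N := fun n =>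
  Real.exp (windowInv hm hNm
    (fun k => Real.log ((-1) ^ (m - 1) * L 0 k) - Real.log (-L (Fin.last m) k)) n)

/-- The sequence `s = a⁻¹` of the gauge transformation that brings `L` to the slice. -/
def normS (L : DO N m) : Seq N := fun n => ((-1) ^ (m - 1) * L 0 n)⁻¹

/-- The coordinates of the operator of the slice that is gauge equivalent to `L`. -/
def normalForm (L : DO N m) : Slice N m := sliceProj (gauge (normS L) (normP hm hNm L) L)

lemma normP_gauge {s p : Seq N} (hs : ∀ n, 0 < s n) (hp : ∀ n, 0 < p n) {L : DO N m}
    (hL : L ∈ gaugeDomain N m) (n : ZMod N) :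
    normP hm hNm (gauge s p L) n = normP hm hNm L n / p n := by
  have e : (fun k => Real.log ((-1) ^ (m - 1) * gauge s p L 0 k) -
      Real.log (-gauge s p L (Fin.last m) k)) =
      (fun k => Real.log ((-1) ^ (m - 1) * L 0 k) - Real.log (-L (Fin.last m) k)) -
        windowSum N m (fun k => Real.log (p k)) := by
    funext k
    have hP : ∏ j ∈ Finset.range m, p (k + (j : ZMod N)) ≠ 0 :=
      Finset.prod_ne_zero_iff.2 fun _ _ => (hp _).ne'
    have h1 : (-1 : ℝ) ^ (m - 1) * gauge s p L 0 k = s k * ((-1) ^ (m - 1) * L 0 k) := by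
      rw [gauge_apply]; simp; ring
    have h2 : -gauge s p L (Fin.last m) k =
        s k * (-L (Fin.last m) k) * ∏ j ∈ Finset.range m, p (k + (j : ZMod N)) := by
      rw [gauge_apply, Fin.val_last]; ring
    have h3 : -L (Fin.last m) k ≠ 0 := neg_ne_zero.2 (hL k).2.ne
    rw [Pi.sub_apply, h1, h2, Real.log_mul (hs k).ne' (hL k).1.ne',
      Real.log_mul (mul_ne_zero (hs k).ne' h3) hP, Real.log_mul (hs k).ne' h3,
      Real.log_prod fun _ _ => (hp _).ne', windowSum_apply]
    ring
  rw [normP, e, map_sub, windowInv_windowSum, Pi.sub_apply, Real.exp_sub, Real.exp_log (hp n)]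
  rfl

lemma normalForm_gauge {s p : Seq N} (hs : ∀ n, 0 < s n) (hp : ∀ n, 0 < p n) {L : DO N m}
    (hL : L ∈ gaugeDomain N m) :
    normalForm hm hNm (gauge s p L) = normalForm hm hNm L := by
  rw [normalForm, normalForm]
  congr 1
  funext k n
  have hS : normS (gauge s p L) n = normS L n / s n := by
    rw [normS, normS, gauge_apply, Fin.val_zero, Finset.range_zero, Finset.prod_empty, mul_one,
      mul_left_comm, mul_inv, div_eq_inv_mul]
  have hP : ∏ j ∈ Finset.range (k : ℕ), p (n + (j : ZMod N)) ≠ 0 :=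
    Finset.prod_ne_zero_iff.2 fun _ _ => (hp _).ne'
  have hs' := (hs n).ne'
  simp only [gauge_apply _ _ (gauge s p L), hS, normP_gauge hm hNm hs hp hL,
    Finset.prod_div_distrib]
  rw [gauge_apply, gauge_apply]
  field_simp

lemma normalForm_sliceOp (a : Slice N m) : normalForm hm hNm (sliceOp a) = a := by
  have h0 : ∀ n, (-1 : ℝ) ^ (m - 1) * sliceOp a 0 n = 1 := fun n => by
    rw [sliceOp_zero, ← mul_pow]; norm_num
  have h1 : ∀ n, sliceOp a (Fin.last m) n = -1 := fun n => by
    have h : ((Fin.last m : Fin (m + 1)) : ℕ) ≠ 0 := by rw [Fin.val_last]; omega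
    rw [sliceOp, dif_neg h, dif_pos (Fin.val_last m)]
  have hS : ∀ n, normS (sliceOp a) n = 1 := fun n => by rw [normS, h0, inv_one]
  have hP : ∀ n, normP hm hNm (sliceOp a) n = 1 := fun n => by
    have e : (fun k => Real.log ((-1) ^ (m - 1) * sliceOp a 0 k) -
        Real.log (-sliceOp a (Fin.last m) k)) = (0 : Seq N) := by
      funext k
      rw [h0, h1]
      simp
    rw [normP, e, map_zero, Pi.zero_apply, Real.exp_zero]
  rw [normalForm]
  conv_rhs => rw [← sliceProj_sliceOp a]
  congr 1
  funext k n
  simp [gauge_apply, hS, hP]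

lemma contDiffAt_normalForm {L : DO N m} (hL : L ∈ gaugeDomain N m) :
    ContDiffAt ℝ ∞ (normalForm hm hNm) L := by
  have hc : ∀ (k : Fin (m + 1)) (n : ZMod N), ContDiffAt ℝ ∞ (fun L : DO N m => L k n) L :=
    fun k n => by fun_prop
  have hS : ∀ n, ContDiffAt ℝ ∞ (fun L : DO N m => normS L n) L := fun n =>
    (contDiffAt_const.mul (hc 0 n)).inv (hL n).1.ne'
  have hlog : ContDiffAt ℝ ∞ (fun L : DO N m => (fun k =>
      Real.log ((-1) ^ (m - 1) * L 0 k) - Real.log (-L (Fin.last m) k) : Seq N)) L :=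
    contDiffAt_pi.2 fun k => ((contDiffAt_const.mul (hc 0 k)).log (hL k).1.ne').sub
      ((hc _ k).neg.log (neg_ne_zero.2 (hL k).2.ne))
  have hP : ∀ n, ContDiffAt ℝ ∞ (fun L : DO N m => normP hm hNm L n) L := fun n =>
    (contDiffAt_pi.1 ((LinearMap.toContinuousLinearMap
      (windowInv hm hNm)).contDiff.contDiffAt.comp L hlog) n).exp
  refine contDiffAt_pi.2 fun j => contDiffAt_pi.2 fun n => ?_
  simp only [normalForm, sliceProj_apply, gauge_apply]
  exact ((hS n).mul (hc _ n)).mul (contDiffAt_prod fun i _ => hP _)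

open Classical in
/-- The function on `DO(N, m)` that is `f` of the normal form where this exists, and zero
elsewhere. -/
def invariantExtension (f : Slice N m → ℝ) (L : DO N m) : ℝ :=
  if L ∈ gaugeDomain N m then f (normalForm hm hNm L) else 0

lemma isInvariantExtension_invariantExtension {f : Slice N m → ℝ} (hf : ContDiff ℝ ∞ f) :
    IsInvariantExtension f (invariantExtension hm hNm f) where
  invariant s p hs hp L := by
    rw [invariantExtension, invariantExtension]
    by_cases hL : L ∈ gaugeDomain N m
    · rw [if_pos hL, if_pos ((gauge_mem_gaugeDomain hs hp L).2 hL),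
        normalForm_gauge hm hNm hs hp hL]
    · rw [if_neg hL, if_neg fun h => hL ((gauge_mem_gaugeDomain hs hp L).1 h)]
  smooth a := by
    have ha := sliceOp_mem_gaugeDomain hm a
    refine (hf.contDiffAt.comp _ (contDiffAt_normalForm hm hNm ha)).congr_of_eventuallyEq ?_
    filter_upwards [isOpen_gaugeDomain.mem_nhds ha] with L hL
    exact if_pos hL
  extends_f a := by
    rw [invariantExtension, if_pos (sliceOp_mem_gaugeDomain hm a), normalForm_sliceOp]

end Extension

end DiffOp

end

theorem mainTheorem1 (N m : ℕ) [NeZero N] :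
    -- every push-forward bracket is Poisson
    (∀ l : ℝˣ, DiffOp.IsPoissonBracket (DiffOp.pencil (N := N) (m := m) l)) ∧
    -- they form a Poisson pencil, linear in the parameter, with companion bracket `{,}₂`
    (∃ B₀ : (DiffOp.DO N m → ℝ) → (DiffOp.DO N m → ℝ) → DiffOp.DO N m → ℝ,
      (∀ l : ℝˣ, ∀ F G : DiffOp.DO N m → ℝ, ContDiff ℝ ∞ F → ContDiff ℝ ∞ G →
        ∀ D, DiffOp.pencil l F G D = B₀ F G D + (l : ℝ) * DiffOp.bracket2 F G D) ∧
      (∀ l : ℝ, DiffOp.IsPoissonBracket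
        (fun F G D => B₀ F G D + l * DiffOp.bracket2 F G D)) ∧
      (∀ s t : ℝ, DiffOp.IsPoissonBracket
        (fun F G D => s * B₀ F G D + t * DiffOp.bracket2 F G D))) ∧
    -- the companion bracket at the operators with zero-order term `(-1)^{m-1}`
    (1 ≤ m → ∀ F G : DiffOp.DO N m → ℝ, ContDiff ℝ ∞ F → ContDiff ℝ ∞ G →
      ∀ D : DiffOp.DO N m, D 0 = (fun _ => (-1) ^ (m - 1)) →
        DiffOp.bracket2 F G D =
          DiffOp.linearTensor m (DiffOp.toOp D) (DiffOp.grad F D) (DiffOp.grad G D)) ∧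
    -- the companion bracket on the `SL(m)` reduction
    (1 ≤ m → Nat.Coprime N m →
      (∀ f : DiffOp.Slice N m → ℝ, ContDiff ℝ ∞ f →
        ∃ F : DiffOp.DO N m → ℝ, DiffOp.IsInvariantExtension f F) ∧
      ∃ B : (DiffOp.Slice N m → ℝ) → (DiffOp.Slice N m → ℝ) → DiffOp.Slice N m → ℝ,
        DiffOp.IsPoissonBracket B ∧
        (∀ f g : DiffOp.Slice N m → ℝ, ContDiff ℝ ∞ f → ContDiff ℝ ∞ g →
          ∀ F G : DiffOp.DO N m → ℝ,
            DiffOp.IsInvariantExtension f F → DiffOp.IsInvariantExtension g G →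
            ∀ a : DiffOp.Slice N m,
              B f g a = DiffOp.bracket2 F G (DiffOp.sliceOp a) ∧
              B f g a = DiffOp.linearTensor m (DiffOp.toOp (DiffOp.sliceOp a))
                (DiffOp.grad F (DiffOp.sliceOp a)) (DiffOp.grad G (DiffOp.sliceOp a))) ∧
        (∀ f g : DiffOp.Slice N m →L[ℝ] ℝ, ∃ (u : DiffOp.Slice N m →L[ℝ] ℝ) (c : ℝ),
          ∀ a, B f g a = u a + c)) := by
  refine ⟨DiffOp.isPoissonBracket_pencil,
    ⟨fun F G D => DiffOp.pencil 1 F G D - DiffOp.bracket2 F G D, ?_, ?_, ?_⟩, ?_, ?_⟩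
  · intro l F G _ _ D
    rw [DiffOp.pencil_eq l]
    ring
  · intro l
    simpa only [one_mul] using DiffOp.isPoissonBracket_combination 1 l
  · exact DiffOp.isPoissonBracket_combination
  · intro _ F G _ _ D hD
    exact DiffOp.companionTensor_eq_linearTensor D hD _ _
  · intro hm hNm
    refine ⟨fun f hf => ⟨_, DiffOp.isInvariantExtension_invariantExtension hm hNm hf⟩,
      DiffOp.sliceBracket, DiffOp.isPoissonBracket_sliceBracket, ?_, DiffOp.sliceBracket_linear⟩
    intro f g hf hg F G hF hG a
    have h := DiffOp.sliceBracket_eq hf hg hF hG a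
    exact ⟨h, h.trans
      (DiffOp.companionTensor_eq_linearTensor _ (DiffOp.sliceOp_zero a) _ _)⟩
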